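/- **Chung's Laplacian question has a negative answer.** *Notation.* Let $G$ be a finite simple graph with vertex set $V$. For $X,Y\subseteq V$ let $e(X,Y)$ be the number of ordered pairs $(u,v)$ with $u\in X$, $v\in Y$ and $u$ adjacent to $v$, and let $\operatorname{vol}X=\sum_{v\in X}d(v)$. Let $\mathcal L(G)$ be the normalized Laplacian of $G$: its $(u,u)$ entry is $1$ if $d(u)>0$ and $0$ otherwise, and for $u\ne v$ its $(u,v)$ entry is $-1/\sqrt{d(u)d(v)}$ if $u,v$ are adjacent and $0$ otherwise; so $\mathcal L(G)=I-\frac1dA$ if $G$ is $d$-regular with $d>0$ and adjacency matrix $A$. Let $\lambda_0\le\dots\le\lambda_{n-1}$ be the eigenvalues of $\mathcal L(G)$, and put $\overline\lambda(G)=\max_{i\neq0}|1-\lambda_i|$. For $\alpha>0$ we say that $G$ satisfies $\mathrm{D}(\alpha)$ if for all $X,Y\subseteq V$ $$\left|e(X,Y)-\frac{\operatorname{vol}X\,\operatorname{vol}Y}{\operatorname{vol}V}\right|\le\alpha\,\frac{\sqrt{\operatorname{vol}X\,\operatorname{vol}Y\,\operatorname{vol}(V\setminus X)\,\operatorname{vol}(V\setminus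 Y)}}{\operatorname{vol}V}.$$ Chung asked whether there is an absolute constant $C$ such that $\overline\lambda(G)\le C\alpha$ whenever $G$ is a nonempty graph (a graph with at least one edge) and $\alpha>0$ is such that $G$ satisfies $\mathrm{D}(\alpha)$. *The graphs $G_p$.* Let $p$ be a prime and $k=\lceil p^{1/5}\rceil$. For $1\le t\le p$ let $Q(p,t)$ be the (regular) graph on $\{1,\dots,p\}$ in which distinct $u,v$ are joined if and only if the fractional part of $(u-v)^2/p$ is at most $t/p$. Let $\mathcal V_p$ be the set of the degrees of the graphs $Q(p,t)$, $1\le t\le p$; for each $d\in\mathcal V_p$ choose $t$ such that $Q(p,t)$ is $d$-regular, and let $A(p,d)$ be the adjacency matrix of this $Q(p,t)$. For $1\le i,j\le k$ let $d_{ij}=d_{ji}$ be an element of $\mathcal V_p$ nearest to $\frac p2+\frac p{2\sqrt{ij}}$. Let $\mathcal A'$ be the $kp\times kp$ block matrix with blocks $A(p,d_{ij})$, let $E$ be the $kp\times kp$ all-ones matrix, and let $G_p$ be the graph with adjacency matrix $$\mathcal A=\begin{pmatrix}\mathcal A'&E-\mathcal A'\\E-\mathcal A'&\mathcal A'\end{pmatrix}.$$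 *Claim.* There is an absolute constant $C>0$ such that the following hold, whatever choices are made in the construction. 1. For every sufficiently large prime $p$, the graph $G_p$ has order $2kp$, is $kp$-regular, satisfies $\mathrm{D}(\alpha)$ with $\alpha=C/k$, and $$\overline\lambda(G_p)\ge\frac{\log k}{2k}.$$ 2. For every real $K$ and every sufficiently large prime $p$ (depending on $K$), $\overline\lambda(G_p)>K\cdot C/k$. Consequently there is no absolute constant $K$ such that $\overline\lambda(G)\le K\alpha$ for all nonempty regular graphs $G$ and all $\alpha>0$ for which $G$ satisfies $\mathrm{D}(\alpha)$; so Chung's question has a negative answer, even for regular graphs. -/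

import Mathlib

namespace ChungLaplacian

/-! ### Volumes, edge counts and the normalized Laplacian of a finite graph -/

section General

variable {V : Type*} [Fintype V]

open Classical in
/-- `e(X, Y)`: the number of ordered pairs `(u, v)` with `u ∈ X`, `v ∈ Y` and `u` adjacent
to `v`. -/
noncomputable def edgeCount (G : SimpleGraph V) (X Y : Finset V) : ℕ :=
  (G.interedges X Y).card

open Classical in
/-- `vol X`: the sum of the degrees of the vertices in `X`. -/
noncomputable def vol (G : SimpleGraph V) (X : Finset V) : ℕ :=
  ∑ v ∈ X, G.degree v

open Classical in
/-- `G` is `d`-regular. -/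
def IsRegular (G : SimpleGraph V) (d : ℕ) : Prop :=
  G.IsRegularOfDegree d

open Classical in
/-- The volume-discrepancy condition with parameter `α`. -/
def VolDiscrepancy (G : SimpleGraph V) (α : ℝ) : Prop :=
  ∀ X Y : Finset V,
    |(edgeCount G X Y : ℝ) - (vol G X : ℝ) * (vol G Y : ℝ) / (vol G Finset.univ : ℝ)|
      ≤ α * (√((vol G X : ℝ) * (vol G Y : ℝ) * (vol G Xᶜ : ℝ) * (vol G Yᶜ : ℝ))
          / (vol G Finset.univ : ℝ))

open Classical in
/-- The normalized Laplacian `𝓛(G)`. -/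
noncomputable def normalizedLaplacian (G : SimpleGraph V) : Matrix V V ℝ :=
  Matrix.of fun u v =>
    if u = v then (if G.degree v = 0 then 0 else 1)
    else if G.Adj u v then -(1 / √((G.degree u : ℝ) * (G.degree v : ℝ))) else 0

theorem normalizedLaplacian_isHermitian (G : SimpleGraph V) :
    (normalizedLaplacian G).IsHermitian := by
  classical
  ext u v
  by_cases h : u = v
  · subst h; simp
  · have h' : ¬ v = u := fun e => h e.symm
    simp [normalizedLaplacian, h, h', G.adj_comm u v, mul_comm]

open Classical in
/-- For a `d`-regular graph with `d > 0`, the normalized Laplacian is `I - (1 / d) A`. -/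
theorem normalizedLaplacian_of_isRegular (G : SimpleGraph V) (d : ℕ) (hd : 0 < d)
    (hG : IsRegular G d) :
    normalizedLaplacian G = 1 - (1 / (d : ℝ)) • G.adjMatrix ℝ := by
  have hdeg : ∀ v, G.degree v = d := fun v => hG v
  ext u v
  by_cases h : u = v
  · subst h
    simp [normalizedLaplacian, hdeg, hd.ne']
  · by_cases ha : G.Adj u v <;>
      simp [normalizedLaplacian, hdeg, h, ha]

open Classical in
/-- The eigenvalues of the normalized Laplacian, with multiplicity and in increasing order
`λ₀ ≤ λ₁ ≤ ⋯ ≤ λₙ₋₁` (Mathlib lists the eigenvalues of a Hermitian matrix in decreasing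
order). -/
noncomputable def lapEigenvalue (G : SimpleGraph V) (i : Fin (Fintype.card V)) : ℝ :=
  (normalizedLaplacian_isHermitian G).eigenvalues₀ i.rev

/-- `λ̄ = max_{i ≠ 0} |1 - λᵢ|`. -/
noncomputable def lambdaBar (G : SimpleGraph V) : ℝ :=
  ⨆ i : {i : Fin (Fintype.card V) // i.val ≠ 0}, |1 - lapEigenvalue G i.val|

end General

/-! ### The graphs `G_p` -/

/-- The graph `Q(p, t)` on `p` vertices: distinct `u, v` are joined if and only if the
fractional part of `(u - v)² / p` is at most `t / p`. -/
def Q (p t : ℕ) : SimpleGraph (Fin p) where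
  Adj u v := u ≠ v ∧
    Int.fract ((((u.val : ℝ) - (v.val : ℝ)) ^ 2) / (p : ℝ)) ≤ (t : ℝ) / (p : ℝ)
  symm := ⟨fun u v h => ⟨h.1.symm, by
    have e : ((v.val : ℝ) - (u.val : ℝ)) ^ 2 = ((u.val : ℝ) - (v.val : ℝ)) ^ 2 := by ring
    rw [e]; exact h.2⟩⟩
  loopless := ⟨fun _ h => h.1 rfl⟩

/-- The set `𝒱_p` of the degrees of the (regular) graphs `Q(p, t)`, `1 ≤ t ≤ p`. -/
def degreeSet (p : ℕ) : Set ℕ :=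
  {d | ∃ t ∈ Finset.Icc 1 p, IsRegular (Q p t) d}

/-- `k = ⌈p^(1/5)⌉`. -/
noncomputable def blockNumber (p : ℕ) : ℕ :=
  ⌈(p : ℝ) ^ ((1 : ℝ) / 5)⌉₊

/-- The number `p / 2 + p / (2 √(i j))` that `d_{ij}` has to approximate; the indices `i, j`
of the text run from `1`, those of `Fin` from `0`. -/
noncomputable def target (p : ℕ) (i j : Fin (blockNumber p)) : ℝ :=
  (p : ℝ) / 2 + (p : ℝ) / (2 * √(((i.val : ℝ) + 1) * ((j.val : ℝ) + 1)))

/-- The choices made in the construction of `G_p`: a symmetric matrix `D = (d_{ij})` whose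
entry `d_{ij}` is an element of `𝒱_p` nearest to `p / 2 + p / (2 √(i j))`, and for each
`d ∈ 𝒱_p` a parameter `t = T d` such that `Q(p, t)` is `d`-regular. -/
structure Choices (p : ℕ) where
  D : Fin (blockNumber p) → Fin (blockNumber p) → ℕ
  D_symm : ∀ i j, D i j = D j i
  D_mem : ∀ i j, D i j ∈ degreeSet p
  D_nearest : ∀ i j, ∀ x ∈ degreeSet p, |(D i j : ℝ) - target p i j| ≤ |(x : ℝ) - target p i j|
  T : ℕ → ℕ
  T_mem : ∀ d ∈ degreeSet p, T d ∈ Finset.Icc 1 p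
  T_regular : ∀ d ∈ degreeSet p, IsRegular (Q p (T d)) d

theorem degreeSet_finite (p : ℕ) : (degreeSet p).Finite := by
  classical
  refine (Set.finite_Iic p).subset ?_
  rintro d ⟨t, ht, hd⟩
  have hp : 0 < p := by have := Finset.mem_Icc.1 ht; omega
  have h1 := hd ⟨0, hp⟩
  rw [← h1]
  have h2 := SimpleGraph.degree_lt_card_verts (G := Q p t) (v := ⟨0, hp⟩)
  rw [Fintype.card_fin] at h2
  exact h2.le

theorem degreeSet_nonempty (p : ℕ) (hp : 0 < p) : (degreeSet p).Nonempty := by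
  classical
  refine ⟨p - 1, p, Finset.mem_Icc.2 ⟨hp, le_rfl⟩, ?_⟩
  have e : Q p p = ⊤ := by
    ext u v
    have h0 : (p : ℝ) ≠ 0 := by exact_mod_cast hp.ne'
    simp only [Q, SimpleGraph.top_adj, div_self h0, and_iff_left_iff_imp]
    exact fun _ => (Int.fract_lt_one _).le
  rw [e]
  unfold IsRegular
  intro v
  have h := SimpleGraph.IsRegularOfDegree.top (V := Fin p) v
  rw [Fintype.card_fin] at h
  convert h

/-- The choices can be made. -/
theorem nonempty_choices (p : ℕ) (hp : 0 < p) : Nonempty (Choices p) := by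
  classical
  have hne : ∀ x : ℝ, ∃ d ∈ degreeSet p, ∀ y ∈ degreeSet p, |(d : ℝ) - x| ≤ |(y : ℝ) - x| :=
    fun x => Set.exists_min_image _ (fun d : ℕ => |(d : ℝ) - x|) (degreeSet_finite p)
      (degreeSet_nonempty p hp)
  choose f hf hf' using hne
  have hT : ∀ d, ∃ t, d ∈ degreeSet p → t ∈ Finset.Icc 1 p ∧ IsRegular (Q p t) d := by
    intro d
    by_cases h : d ∈ degreeSet p
    · obtain ⟨t, h1, h2⟩ := h
      exact ⟨t, fun _ => ⟨h1, h2⟩⟩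
    · exact ⟨0, fun h' => absurd h' h⟩
  choose T hT using hT
  exact ⟨{
    D := fun i j => f (target p i j)
    D_symm := fun i j => by rw [target, target, mul_comm ((i.val : ℝ) + 1)]
    D_mem := fun i j => hf _
    D_nearest := fun i j => hf' _
    T := T
    T_mem := fun d h => (hT d h).1
    T_regular := fun d h => (hT d h).2 }⟩

/-- Each half of the vertex set of `G_p` consists of `k` classes of `p` vertices. -/
abbrev Half (p : ℕ) : Type := Fin (blockNumber p) × Fin p

/-- The vertex set of `G_p`, with `2 k p` elements. -/
abbrev Vertex (p : ℕ) : Type := Half p ⊕ Half p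

open Classical in
/-- The matrix `𝒜'`: its block in position `(i, j)` is the adjacency matrix `A(p, d_{ij})` of
the chosen `d_{ij}`-regular graph `Q(p, t)`. -/
noncomputable def matrixA' (p : ℕ) (c : Choices p) : Matrix (Half p) (Half p) ℝ :=
  Matrix.of fun x y => (Q p (c.T (c.D x.1 y.1))).adjMatrix ℝ x.2 y.2

/-- The matrix `𝒜`, with blocks `𝒜'` on the diagonal and `E - 𝒜'` off the diagonal, where `E`
is the all-ones matrix. -/
noncomputable def matrixA (p : ℕ) (c : Choices p) : Matrix (Vertex p) (Vertex p) ℝ :=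
  Matrix.fromBlocks (matrixA' p c) (Matrix.of (fun _ _ => 1) - matrixA' p c)
    (Matrix.of (fun _ _ => 1) - matrixA' p c) (matrixA' p c)

/-- `𝒜` is a symmetric `(0, 1)`-matrix with zero main diagonal. -/
theorem matrixA_isAdjMatrix (p : ℕ) (c : Choices p) : (matrixA p c).IsAdjMatrix := by
  classical
  have h01 : ∀ x y, matrixA' p c x y = 0 ∨ matrixA' p c x y = 1 := by
    intro x y
    by_cases h : (Q p (c.T (c.D x.1 y.1))).Adj x.2 y.2 <;> simp [matrixA', h]
  have hs : ∀ x y, matrixA' p c x y = matrixA' p c y x := by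
    intro x y
    simp [matrixA', c.D_symm x.1 y.1, SimpleGraph.adj_comm _ x.2 y.2]
  have hd : ∀ x, matrixA' p c x x = 0 := by
    intro x
    simp [matrixA']
  refine ⟨?_, ?_, ?_⟩
  · rintro (x | x) (y | y) <;> rcases h01 x y with h | h <;> simp [matrixA, h]
  · ext (x | x) (y | y) <;> simp [matrixA, hs x y]
  · rintro (x | x) <;> simp [matrixA, hd x]

/-- The graph `G_p` with adjacency matrix `𝒜`. -/
noncomputable def graph (p : ℕ) (c : Choices p) : SimpleGraph (Vertex p) :=
  (matrixA_isAdjMatrix p c).toGraph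

end ChungLaplacian

namespace ChungLaplacian

/-! The condition D(α) tests the adjacency matrix only on 0/1 vectors, whereas `lambdaBar` sees all
vectors; the graph is built so that this costs a logarithm. Subtract 1/2 from every entry of `𝒜`. In
the block (i, j) what remains averages to about ±1/(2√(ij)), with sign + inside a half and - across
halves. So up to pseudorandom noise the remainder has rank one.

Lower bound: the vector with value ±1/√i on class i has sum zero and Rayleigh quotient about p·(1 +
1/2 + ... + 1/k), which is at least p log k. Relative to the degree kp this is (log k)/k, and half
of it survives the rounding of degrees (`testVector_quadratic_form_ge`,
`le_lambdaBar_of_isRegular`).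

Discrepancy: a set with nᵢ ≤ p points in class i satisfies ∑ nᵢ/√i ≤ 2√(p ∑ nᵢ) (`sum_div_sqrt_le`).
Hence the rank one part contributes only O(p√(|X||Y|)), without a logarithm: bounded weights cannot
imitate the vector 1/√i on all scales at once.

Noise: by Fourier analysis on `ZMod p`, each `Q p t` has mixing error of order √p log p
(`abs_sum_adj_sub_le`). Summed over the blocks by Cauchy–Schwarz this costs a factor k, and k√p log
p is below p because k is about p^(1/5). Finally, all row sums of the remainder vanish, so a set may
be exchanged for its complement (`exists_small_side`); this produces the complementary volumes in
D(α). -/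

theorem Q_adj_iff {p t : ℕ} [NeZero p] {u v : Fin p} :
    (Q p t).Adj u v ↔ u ≠ v ∧ (((u.val : ZMod p) - (v.val : ZMod p)) ^ 2).val ≤ t := by
  have hp : (0 : ℝ) < p := by exact_mod_cast Nat.pos_of_ne_zero (NeZero.ne p)
  have e1 : ((((u.val : ZMod p) - (v.val : ZMod p)) ^ 2).val : ℤ)
      = ((u.val : ℤ) - (v.val : ℤ)) ^ 2 % (p : ℤ) := by
    rw [← ZMod.val_intCast]; push_cast; rfl
  have e2 : Int.fract ((((u.val : ℝ) - (v.val : ℝ)) ^ 2) / (p : ℝ))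
      = ((((u.val : ZMod p) - (v.val : ZMod p)) ^ 2).val : ℝ) / p := by
    have := Int.fract_div_intCast_eq_div_intCast_mod (k := ℝ)
      (m := ((u.val : ℤ) - (v.val : ℤ)) ^ 2) (n := p)
    push_cast at this
    rw [this]
    congr 1
    exact_mod_cast e1.symm
  show u ≠ v ∧ _ ↔ _
  rw [e2, div_le_div_iff_of_pos_right hp, Nat.cast_le]

/-! ### Exponential sums and equidistribution of (x - y)² modulo p -/

section Fourier

variable {p : ℕ} [Fact p.Prime]

-- Plancherel: after expanding the square, orthogonality of characters leaves only the diagonal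
-- terms, because multiplication by b ≠ 0 is injective.
open ZMod in
theorem sum_norm_sq_fourier {b : ZMod p} (hb : b ≠ 0) (g : ZMod p → ℂ) :
    ∑ x, ‖∑ y, g y * stdAddChar (x * (b * y))‖ ^ 2 = p * ∑ y, ‖g y‖ ^ 2 := by
  have key : ∑ x, (∑ y, g y * stdAddChar (x * (b * y))) *
      (starRingEnd ℂ) (∑ z, g z * stdAddChar (x * (b * z)))
      = p * ∑ y, g y * (starRingEnd ℂ) (g y) := by
    calc _ = ∑ x : ZMod p, ∑ y, ∑ z, g y * (starRingEnd ℂ) (g z) *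
            stdAddChar (x * (b * (y - z))) := by
          refine Finset.sum_congr rfl fun x _ => ?_
          rw [map_sum, Finset.sum_mul_sum]
          refine Finset.sum_congr rfl fun y _ => Finset.sum_congr rfl fun z _ => ?_
          rw [map_mul (starRingEnd ℂ), ← AddChar.map_neg_eq_conj, mul_sub, mul_sub, sub_eq_add_neg,
            AddChar.map_add_eq_mul]
          ring
      _ = ∑ y, ∑ z, g y * (starRingEnd ℂ) (g z) *
            ∑ x : ZMod p, stdAddChar (x * (b * (y - z))) := by
          rw [Finset.sum_comm]
          refine Finset.sum_congr rfl fun y _ => ?_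
          rw [Finset.sum_comm]
          simp_rw [Finset.mul_sum]
      _ = _ := by
          rw [Finset.mul_sum]
          refine Finset.sum_congr rfl fun y _ => ?_
          rw [Finset.sum_eq_single y]
          · simp [ZMod.card, mul_comm]
          · intro z _ hz
            rw [AddChar.sum_mulShift _ (isPrimitive_stdAddChar p), if_neg, Nat.cast_zero, mul_zero]
            exact mul_ne_zero hb (sub_ne_zero.2 hz.symm)
          · simp
  simp_rw [Complex.mul_conj'] at key
  exact_mod_cast key

open ZMod in
theorem norm_bilinear_fourier_le {b : ZMod p} (hb : b ≠ 0) (f g : ZMod p → ℂ) :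
    ‖∑ x, f x * ∑ y, g y * stdAddChar (x * (b * y))‖
      ≤ √(∑ x, ‖f x‖ ^ 2) * √(p * ∑ y, ‖g y‖ ^ 2) := by
  rw [← sum_norm_sq_fourier hb g]
  refine (norm_sum_le _ _).trans ?_
  simp_rw [norm_mul]
  exact Real.sum_mul_le_sqrt_mul_sqrt _ _ _

-- In a(x - y)² = ax² + ay² - 2axy the squares are unimodular weights on X and Y. What is left is a
-- bilinear Fourier sum with frequency -2a, nonzero since p is odd.
open ZMod in
theorem norm_sum_quadratic_le (hp : p ≠ 2) {a : ZMod p} (ha : a ≠ 0) (X Y : Finset (ZMod p)) :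
    ‖∑ x ∈ X, ∑ y ∈ Y, (stdAddChar (a * (x - y) ^ 2) : ℂ)‖
      ≤ √(X.card) * √(p * Y.card) := by
  have h2 : (2 : ZMod p) ≠ 0 := by
    intro h
    have : ((2 : ℕ) : ZMod p) = 0 := by exact_mod_cast h
    rw [ZMod.natCast_eq_zero_iff] at this
    exact hp ((Nat.prime_dvd_prime_iff_eq Fact.out Nat.prime_two).1 this)
  have hb : -(2 * a) ≠ 0 := neg_ne_zero.2 (mul_ne_zero h2 ha)
  have key := norm_bilinear_fourier_le hb
    (fun x => if x ∈ X then stdAddChar (a * x ^ 2) else 0)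
    (fun y => if y ∈ Y then stdAddChar (a * y ^ 2) else 0)
  have e : ∀ Z : Finset (ZMod p),
      ∑ x, ‖(if x ∈ Z then stdAddChar (a * x ^ 2) else 0 : ℂ)‖ ^ 2 = Z.card := by
    intro Z
    have : ∀ x, ‖(if x ∈ Z then stdAddChar (a * x ^ 2) else 0 : ℂ)‖ ^ 2
        = if x ∈ Z then 1 else 0 := by
      intro x; split_ifs <;> simp
    simp [this]
  rw [e, e] at key
  refine le_trans (le_of_eq ?_) key
  congr 1
  simp only [ite_mul, zero_mul, Finset.sum_ite_mem, Finset.univ_inter]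
  refine Finset.sum_congr rfl fun x _ => ?_
  rw [Finset.mul_sum]
  refine Finset.sum_congr rfl fun y _ => ?_
  rw [← AddChar.map_add_eq_mul, ← AddChar.map_add_eq_mul]
  congr 1
  ring

-- Fourier inversion for the indicator of the interval {0, …, m - 1}.
open ZMod in
theorem indicator_eq_sum_stdAddChar {m : ℕ} (hm : m ≤ p) (z : ZMod p) :
    (if z.val < m then 1 else 0 : ℂ)
      = (1 / p) * ∑ a : ZMod p, (∑ y ∈ Finset.range m, stdAddChar (a * (y : ZMod p)))
          * stdAddChar (-a * z) := by
  have hp : (p : ℂ) ≠ 0 := by exact_mod_cast (Fact.out : p.Prime).ne_zero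
  have e : ∑ a : ZMod p, (∑ y ∈ Finset.range m, stdAddChar (a * (y : ZMod p)))
          * stdAddChar (-a * z)
      = ∑ y ∈ Finset.range m, if z.val = y then (p : ℂ) else 0 := by
    simp_rw [Finset.sum_mul]
    rw [Finset.sum_comm]
    refine Finset.sum_congr rfl fun y hy => ?_
    have e1 : ∀ a : ZMod p, (stdAddChar (a * (y : ZMod p)) : ℂ) * stdAddChar (-a * z)
        = stdAddChar (a * ((y : ZMod p) - z)) := by
      intro a
      rw [← AddChar.map_add_eq_mul]; congr 1; ring
    simp_rw [e1]
    rw [AddChar.sum_mulShift _ (isPrimitive_stdAddChar p), ZMod.card]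
    have hy' : y < p := (Finset.mem_range.1 hy).trans_le hm
    have : ((y : ZMod p) - z = 0) ↔ z.val = y := by
      rw [sub_eq_zero]
      constructor
      · rintro rfl; exact ZMod.val_cast_of_lt hy'
      · rintro rfl; exact ZMod.natCast_rightInverse z
    simp [this]
  rw [e, Finset.sum_ite_eq]
  simp only [Finset.mem_range]
  split_ifs <;> simp [hp]

/-- Jordan's inequality gives sin πs ≥ 2 min(s, 1 - s). Bounding the reciprocal of the minimum by
the sum of both reciprocals avoids case distinctions when summing over frequencies. -/
theorem one_div_sin_pi_mul_le {s : ℝ} (h0 : 0 < s) (h1 : s < 1) :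
    1 / Real.sin (Real.pi * s) ≤ (1 / s + 1 / (1 - s)) / 2 := by
  have hpi := Real.pi_pos
  have hs : 2 * min s (1 - s) ≤ Real.sin (Real.pi * s) := by
    rcases le_total s (1 - s) with h | h
    · rw [min_eq_left h]
      have := Real.mul_le_sin (x := Real.pi * s) (by positivity) (by nlinarith)
      refine le_trans (le_of_eq ?_) this
      field_simp
    · rw [min_eq_right h, ← Real.sin_pi_sub]
      have := Real.mul_le_sin (x := Real.pi - Real.pi * s) (by nlinarith) (by nlinarith)
      refine le_trans (le_of_eq ?_) this
      field_simp
  have h1' : 0 < 1 - s := by linarith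
  have hmin : 0 < min s (1 - s) := lt_min h0 h1'
  refine (one_div_le_one_div_of_le (by positivity) hs).trans ?_
  rcases le_total s (1 - s) with h | h
  · rw [min_eq_left h, ← one_div_mul_one_div]
    have : 0 < 1 / (1 - s) := by positivity
    linarith
  · rw [min_eq_right h, ← one_div_mul_one_div]
    have : 0 < 1 / s := by positivity
    linarith

-- A geometric sum whose ratio lies at distance 2 sin(πs) from 1, with s = `a.val / p`.
open ZMod in
theorem norm_geom_stdAddChar_le {a : ZMod p} (ha : a ≠ 0) (m : ℕ) :
    ‖∑ y ∈ Finset.range m, (stdAddChar (a * (y : ZMod p)) : ℂ)‖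
      ≤ p * (1 / (a.val : ℝ) + 1 / ((p : ℝ) - a.val)) / 2 := by
  have hp : (0 : ℝ) < p := by exact_mod_cast (Fact.out : p.Prime).pos
  have hv0 : (0 : ℝ) < a.val := by
    exact_mod_cast Nat.pos_of_ne_zero ((ZMod.val_ne_zero a).2 ha)
  have hvp : (a.val : ℝ) < p := by exact_mod_cast ZMod.val_lt a
  set s : ℝ := a.val / p with hs
  have hs0 : 0 < s := by positivity
  have hs1 : s < 1 := (div_lt_one hp).2 hvp
  have hsin : 0 < Real.sin (Real.pi * s) :=
    Real.sin_pos_of_pos_of_lt_pi (by have := Real.pi_pos; positivity)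
      (by have := Real.pi_pos; nlinarith)
  have hn : ‖(stdAddChar a : ℂ) - 1‖ = 2 * Real.sin (Real.pi * s) := by
    have e : (stdAddChar a : ℂ) = Complex.exp (Complex.I * ((2 * (Real.pi * s) : ℝ) : ℂ)) := by
      conv_lhs => rw [← ZMod.natCast_rightInverse a]
      have := stdAddChar_coe (N := p) (a.val : ℤ)
      rw [Int.cast_natCast] at this
      rw [this, hs]
      congr 1
      push_cast
      ring
    rw [e, Complex.norm_exp_I_mul_ofReal_sub_one, Real.norm_eq_abs, mul_div_cancel_left₀ _ two_ne_zero,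
      abs_of_pos (by positivity)]
  have hne : (stdAddChar a : ℂ) ≠ 1 := by
    intro h
    rw [h, sub_self, norm_zero] at hn
    linarith
  have e : ∀ y : ℕ, (stdAddChar (a * (y : ZMod p)) : ℂ) = (stdAddChar a) ^ y := by
    intro y
    rw [← AddChar.map_nsmul_eq_pow, nsmul_eq_mul, mul_comm]
  simp_rw [e]
  rw [geom_sum_eq hne, norm_div, hn]
  have hnum : ‖(stdAddChar a : ℂ) ^ m - 1‖ ≤ 2 := by
    refine (norm_sub_le _ _).trans ?_
    rw [norm_pow, AddChar.norm_apply]; norm_num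
  calc ‖(stdAddChar a : ℂ) ^ m - 1‖ / (2 * Real.sin (Real.pi * s))
      ≤ 2 / (2 * Real.sin (Real.pi * s)) := by gcongr
    _ = 1 / Real.sin (Real.pi * s) := by field_simp
    _ ≤ (1 / s + 1 / (1 - s)) / 2 := one_div_sin_pi_mul_le hs0 hs1
    _ = _ := by
      have : (p : ℝ) - a.val ≠ 0 := by linarith
      have h3 : 1 - s = (p - a.val) / p := by rw [hs]; field_simp
      rw [h3, hs]
      field_simp

/-- The reflection a ↦ p - a identifies the two sums of reciprocals, so their mean is the harmonic
number of p - 1. -/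
theorem sum_inv_val_le :
    ∑ a ∈ (Finset.univ.erase (0 : ZMod p)), (1 / (a.val : ℝ) + 1 / ((p : ℝ) - a.val)) / 2
      ≤ 1 + Real.log p := by
  have hp1 : 1 ≤ p := (Fact.out : p.Prime).one_le
  have e1 : ∑ a ∈ (Finset.univ.erase (0 : ZMod p)), (1 / (a.val : ℝ) + 1 / ((p : ℝ) - a.val)) / 2
      = ∑ i ∈ Finset.range (p - 1), (1 / ((i : ℝ) + 1) + 1 / (((p - 1 - 1 - i : ℕ) : ℝ) + 1)) / 2 := by
    refine Finset.sum_nbij' (fun a => a.val - 1) (fun i => ((i + 1 : ℕ) : ZMod p)) ?_ ?_ ?_ ?_ ?_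
    · intro a ha
      have h0 := (ZMod.val_ne_zero a).2 (Finset.ne_of_mem_erase ha)
      have := ZMod.val_lt a
      rw [Finset.mem_range]; omega
    · intro i hi
      have hi := Finset.mem_range.1 hi
      refine Finset.mem_erase.2 ⟨?_, Finset.mem_univ _⟩
      rw [← ZMod.val_ne_zero, ZMod.val_cast_of_lt (by omega)]
      omega
    · intro a ha
      have h0 := (ZMod.val_ne_zero a).2 (Finset.ne_of_mem_erase ha)
      show ((a.val - 1 + 1 : ℕ) : ZMod p) = a
      rw [Nat.sub_add_cancel (by omega)]
      exact ZMod.natCast_rightInverse a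
    · intro i hi
      have hi := Finset.mem_range.1 hi
      show ((i + 1 : ℕ) : ZMod p).val - 1 = i
      rw [ZMod.val_cast_of_lt (by omega)]
      omega
    · intro a ha
      have h0 := (ZMod.val_ne_zero a).2 (Finset.ne_of_mem_erase ha)
      have h1 := ZMod.val_lt a
      have e2 : ((a.val - 1 : ℕ) : ℝ) + 1 = a.val := by
        rw [Nat.cast_sub (by omega)]; simp
      have e3 : ((p - 1 - 1 - (a.val - 1) : ℕ) : ℝ) + 1 = p - a.val := by
        rw [show p - 1 - 1 - (a.val - 1) = p - a.val - 1 by omega, Nat.cast_sub (by omega),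
          Nat.cast_sub (by omega)]
        simp
      simp only [e2, e3]
  rw [e1, ← Finset.sum_div, Finset.sum_add_distrib,
    Finset.sum_range_reflect (fun i : ℕ => 1 / ((i : ℝ) + 1)) (p - 1), add_self_div_two]
  have h := harmonic_le_one_add_log (p - 1)
  have e2 : ((harmonic (p - 1) : ℚ) : ℝ) = ∑ i ∈ Finset.range (p - 1), 1 / ((i : ℝ) + 1) := by
    simp [harmonic]
  rw [← e2]
  refine h.trans ?_
  rcases Nat.eq_zero_or_pos (p - 1) with h0 | h0
  · rw [h0]; simpa using Real.log_nonneg (by exact_mod_cast hp1)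
  · gcongr
    omega

/-- Equidistribution of `(x - y) ^ 2` in initial intervals, for `x ∈ X` and `y ∈ Y`. -/
theorem abs_sum_val_sq_lt_sub_le (hp : p ≠ 2) {m : ℕ} (hm : m ≤ p) (X Y : Finset (ZMod p)) :
    |(∑ x ∈ X, ∑ y ∈ Y, if ((x - y) ^ 2).val < m then (1 : ℝ) else 0)
        - (m : ℝ) / p * (X.card * Y.card)|
      ≤ √p * (1 + Real.log p) * (√X.card * √Y.card) := by
  have hp0 : (0 : ℝ) < p := by exact_mod_cast (Fact.out : p.Prime).pos
  set c : ZMod p → ℂ := fun a => ∑ y ∈ Finset.range m, ZMod.stdAddChar (a * (y : ZMod p)) with hc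
  set S : ZMod p → ℂ := fun a => ∑ x ∈ X, ∑ y ∈ Y, ZMod.stdAddChar (-a * (x - y) ^ 2) with hS
  have e1 : ((∑ x ∈ X, ∑ y ∈ Y, if ((x - y) ^ 2).val < m then (1 : ℝ) else 0 : ℝ) : ℂ)
      = (1 / p) * ∑ a, c a * S a := by
    have e : ∀ x y : ZMod p, (((if ((x - y) ^ 2).val < m then (1 : ℝ) else 0) : ℝ) : ℂ)
        = (1 / p) * ∑ a, c a * ZMod.stdAddChar (-a * (x - y) ^ 2) := by
      intro x y
      rw [← indicator_eq_sum_stdAddChar hm]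
      split_ifs <;> simp
    simp_rw [Complex.ofReal_sum, e, ← Finset.mul_sum]
    congr 1
    simp_rw [hS, Finset.mul_sum]
    exact (Finset.sum_congr rfl fun x _ => Finset.sum_comm).trans Finset.sum_comm
  have c0 : c 0 = m := by simp [hc]
  have S0 : S 0 = X.card * Y.card := by simp [hS]
  have e2 : (((∑ x ∈ X, ∑ y ∈ Y, if ((x - y) ^ 2).val < m then (1 : ℝ) else 0)
        - (m : ℝ) / p * (X.card * Y.card) : ℝ) : ℂ)
      = (1 / p) * ∑ a ∈ Finset.univ.erase 0, c a * S a := by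
    -- The frequency 0 carries exactly the expected count; the others are error.
    rw [Complex.ofReal_sub, e1, ← Finset.add_sum_erase _ _ (Finset.mem_univ (0 : ZMod p)), c0, S0]
    push_cast
    ring
  rw [← Real.norm_eq_abs, ← Complex.norm_real, e2, norm_mul]
  have hSa : ∀ a ∈ Finset.univ.erase (0 : ZMod p), ‖c a * S a‖
      ≤ ((1 / (a.val : ℝ) + 1 / ((p : ℝ) - a.val)) / 2) * (p * (√p * (√X.card * √Y.card))) := by
    intro a ha
    have ha := Finset.ne_of_mem_erase ha
    have h1 := norm_geom_stdAddChar_le ha m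
    have h2 := norm_sum_quadratic_le hp (neg_ne_zero.2 ha) X Y
    rw [norm_mul]
    refine (mul_le_mul h1 h2 (norm_nonneg _) ((norm_nonneg _).trans h1)).trans (le_of_eq ?_)
    rw [Real.sqrt_mul hp0.le]
    ring
  have h3 := (norm_sum_le _ _).trans (Finset.sum_le_sum hSa)
  rw [← Finset.sum_mul] at h3
  have h4 : ‖(1 / p : ℂ)‖ = 1 / p := by simp
  rw [h4]
  calc 1 / (p : ℝ) * ‖∑ a ∈ Finset.univ.erase 0, c a * S a‖
      ≤ 1 / p * ((1 + Real.log p) * (p * (√p * (√X.card * √Y.card)))) := by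
        gcongr
        refine h3.trans ?_
        gcongr
        exact sum_inv_val_le
    _ = _ := by field_simp

end Fourier

/-! ### Degrees of the graphs `Q p t` -/

section Degrees

variable {p : ℕ} [Fact p.Prime]

/-- The residue map from `{0, …, p - 1}` to `ZMod p`. -/
def finEquivZMod (p : ℕ) [NeZero p] : Fin p ≃ ZMod p where
  toFun u := (u.val : ZMod p)
  invFun z := ⟨z.val, ZMod.val_lt z⟩
  left_inv u := Fin.ext (ZMod.val_cast_of_lt u.isLt)
  right_inv z := ZMod.natCast_rightInverse z

theorem Q_adj_iff_finEquivZMod {t : ℕ} {u v : Fin p} :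
    (Q p t).Adj u v ↔ finEquivZMod p u - finEquivZMod p v ≠ 0 ∧
      ((finEquivZMod p u - finEquivZMod p v) ^ 2).val ≤ t := by
  rw [Q_adj_iff, sub_ne_zero, (finEquivZMod p).injective.ne_iff]
  rfl

/-- The common degree of the vertices of `Q p t`. -/
def degreeQ (p t : ℕ) [NeZero p] : ℕ :=
  (Finset.univ.filter fun z : ZMod p => z ≠ 0 ∧ (z ^ 2).val ≤ t).card

theorem isRegular_Q (t : ℕ) : IsRegular (Q p t) (degreeQ p t) := by
  classical
  unfold IsRegular
  intro v
  rw [← SimpleGraph.card_neighborFinset_eq_degree]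
  refine Finset.card_nbij' (fun u => finEquivZMod p v - finEquivZMod p u)
    (fun z => (finEquivZMod p).symm (finEquivZMod p v - z)) ?_ ?_ ?_ ?_
  · intro u hu
    simpa [Q_adj_iff_finEquivZMod] using hu
  · intro z hz
    simpa [Q_adj_iff_finEquivZMod] using hz
  · intro u _
    simp
  · intro z _
    simp

theorem degreeQ_zero : degreeQ p 0 = 0 := by
  rw [degreeQ, Finset.card_eq_zero, Finset.filter_eq_empty_iff]
  rintro z - ⟨h1, h2⟩
  rw [Nat.le_zero, ZMod.val_eq_zero] at h2
  exact h1 (by simpa using h2)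

/-- New neighbours are square roots of t + 1 in a field, hence at most two. -/
theorem degreeQ_succ_le (t : ℕ) : degreeQ p (t + 1) ≤ degreeQ p t + 2 := by
  classical
  have hsub : (Finset.univ.filter fun z : ZMod p => z ≠ 0 ∧ (z ^ 2).val ≤ t + 1)
      ⊆ (Finset.univ.filter fun z : ZMod p => z ≠ 0 ∧ (z ^ 2).val ≤ t) ∪
        (Finset.univ.filter fun z : ZMod p => z ^ 2 = ((t + 1 : ℕ) : ZMod p)) := by
    intro z hz
    simp only [Finset.mem_filter, Finset.mem_univ, true_and, Finset.mem_union] at hz ⊢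
    rcases hz.2.lt_or_eq with h | h
    · exact Or.inl ⟨hz.1, Nat.lt_succ_iff.1 h⟩
    · right
      rw [← h]
      exact (ZMod.natCast_rightInverse _).symm
  refine (Finset.card_le_card hsub).trans ((Finset.card_union_le _ _).trans ?_)
  refine Nat.add_le_add_left ?_ _
  rcases (Finset.univ.filter fun z : ZMod p => z ^ 2 = ((t + 1 : ℕ) : ZMod p)).eq_empty_or_nonempty
    with h | ⟨w, hw⟩
  · rw [h, Finset.card_empty]
    exact Nat.zero_le _
  · refine (Finset.card_le_card (t := {w, -w}) ?_).trans Finset.card_le_two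
    intro z hz
    simp only [Finset.mem_filter, Finset.mem_univ, true_and] at hz hw
    rw [Finset.mem_insert, Finset.mem_singleton]
    exact sq_eq_sq_iff_eq_or_eq_neg.1 (hz.trans hw.symm)

theorem degreeQ_self : degreeQ p p = p - 1 := by
  have : (Finset.univ.filter fun z : ZMod p => z ≠ 0 ∧ (z ^ 2).val ≤ p) = Finset.univ.erase 0 := by
    ext z
    simp [(ZMod.val_lt (z ^ 2)).le]
  rw [degreeQ, this, Finset.card_erase_of_mem (Finset.mem_univ _), Finset.card_univ, ZMod.card]

/-- Discrete intermediate values: degrees start at 0, end at p - 1 and grow by at most 2 per step,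
so the first degree to reach x - 2 is still below x. The bound 2 < x keeps that first parameter away
from 0. -/
theorem exists_degreeQ_near {x : ℝ} (h2 : 2 < x) (hx : x ≤ p) :
    ∃ t ∈ Finset.Icc 1 p, |(degreeQ p t : ℝ) - x| ≤ 2 := by
  classical
  have hp : 1 ≤ p := (Fact.out : p.Prime).one_le
  have hlast : x - 2 ≤ degreeQ p p := by
    rw [degreeQ_self, Nat.cast_sub hp]; push_cast; linarith
  have hex : ∃ t, x - 2 ≤ (degreeQ p t : ℝ) := ⟨p, hlast⟩
  obtain ⟨s, hs⟩ : ∃ s, Nat.find hex = s + 1 := by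
    refine Nat.exists_eq_succ_of_ne_zero fun h => ?_
    have := Nat.find_spec hex
    rw [h, degreeQ_zero] at this
    push_cast at this
    linarith
  have h1 := Nat.find_spec hex
  have h3 : ¬ x - 2 ≤ (degreeQ p s : ℝ) := Nat.find_min hex (by omega)
  have h4 : (degreeQ p (s + 1) : ℝ) ≤ degreeQ p s + 2 := by exact_mod_cast degreeQ_succ_le s
  have h5 := Nat.find_min' hex hlast
  rw [hs] at h1 h5
  refine ⟨s + 1, Finset.mem_Icc.2 ⟨by omega, h5⟩, abs_le.2 ⟨?_, ?_⟩⟩ <;> linarith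

theorem abs_D_sub_target_le (hp : 5 ≤ p) (c : Choices p) (i j : Fin (blockNumber p)) :
    |(c.D i j : ℝ) - target p i j| ≤ 2 := by
  have hp' : (5 : ℝ) ≤ p := by exact_mod_cast hp
  have hs : 1 ≤ √(((i.val : ℝ) + 1) * ((j.val : ℝ) + 1)) := by
    rw [Real.one_le_sqrt]
    have : (0 : ℝ) ≤ i.val := by positivity
    have : (0 : ℝ) ≤ j.val := by positivity
    nlinarith
  have h1 : 0 ≤ (p : ℝ) / (2 * √(((i.val : ℝ) + 1) * ((j.val : ℝ) + 1))) := by positivity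
  have h2 : (p : ℝ) / (2 * √(((i.val : ℝ) + 1) * ((j.val : ℝ) + 1))) ≤ p / 2 := by
    gcongr
    linarith
  obtain ⟨t, ht, htx⟩ := exists_degreeQ_near (p := p) (x := target p i j)
    (by rw [target]; linarith) (by rw [target]; linarith)
  exact (c.D_nearest i j _ ⟨t, ht, isRegular_Q t⟩).trans htx

end Degrees

/-! ### Pseudorandomness of the graphs `Q p t` -/

section Mixing

variable {p : ℕ} [Fact p.Prime]

/-- The error parameter in the mixing estimates for the graphs `Q p t`. -/
noncomputable def mixingError (p : ℕ) : ℝ := √p * (1 + Real.log p) + 1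

theorem mixingError_nonneg (p : ℕ) : 0 ≤ mixingError p := by
  have := Real.log_natCast_nonneg p
  unfold mixingError
  positivity

-- The values at most t number t + 1, capped at p because t = p is allowed. The indicator of the
-- interval also counts the pairs x = y, which are not edges; there are at most √(|X||Y|) of them,
-- whence the summand 1 in `mixingError`.
open Classical in
theorem abs_sum_adj_sub_min_le (hp : p ≠ 2) (t : ℕ) (X Y : Finset (Fin p)) :
    |(∑ x ∈ X, ∑ y ∈ Y, if (Q p t).Adj x y then (1 : ℝ) else 0)
        - ((min (t + 1) p : ℕ) : ℝ) / p * (X.card * Y.card)|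
      ≤ mixingError p * (√X.card * √Y.card) := by
  set f : Fin p ↪ ZMod p := (finEquivZMod p).toEmbedding with hf
  have key := abs_sum_val_sq_lt_sub_le hp (min_le_right (t + 1) p) (X.map f) (Y.map f)
  simp only [Finset.card_map, Finset.sum_map] at key
  have e : (∑ x ∈ X, ∑ y ∈ Y, if (Q p t).Adj x y then (1 : ℝ) else 0)
      = (∑ x ∈ X, ∑ y ∈ Y, if ((f x - f y) ^ 2).val < min (t + 1) p then (1 : ℝ) else 0)
        - ((X ∩ Y).card : ℝ) := by
    have h1 : ∀ x y, (if (Q p t).Adj x y then (1 : ℝ) else 0)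
        = (if ((f x - f y) ^ 2).val < min (t + 1) p then (1 : ℝ) else 0)
          - if x = y then 1 else 0 := by
      intro x y
      by_cases h : x = y
      · subst h
        have := (Fact.out : p.Prime).pos
        simp [this]
      · rw [if_neg h, sub_zero]
        have : (Q p t).Adj x y ↔ ((f x - f y) ^ 2).val < min (t + 1) p := by
          rw [Q_adj_iff_finEquivZMod, sub_ne_zero, (finEquivZMod p).injective.ne_iff, lt_min_iff,
            Nat.lt_succ_iff]
          exact ⟨fun h' => ⟨h'.2, ZMod.val_lt _⟩, fun h' => ⟨h, h'.1⟩⟩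
        simp only [this]
    simp_rw [h1, Finset.sum_sub_distrib, Finset.sum_ite_eq]
    simp
  have hcap : ((X ∩ Y).card : ℝ) ≤ √X.card * √Y.card := by
    have hX : ((X ∩ Y).card : ℝ) ≤ X.card := by
      exact_mod_cast Finset.card_le_card Finset.inter_subset_left
    have hY : ((X ∩ Y).card : ℝ) ≤ Y.card := by
      exact_mod_cast Finset.card_le_card Finset.inter_subset_right
    rw [← Real.mul_self_sqrt (Nat.cast_nonneg (X ∩ Y).card)]
    gcongr
  have hcap0 : (0 : ℝ) ≤ (X ∩ Y).card := Nat.cast_nonneg _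
  rw [e, mixingError, add_mul, one_mul]
  rw [abs_le] at key ⊢
  constructor <;> linarith [key.1, key.2]

theorem card_le_sqrt_mul_sqrt {α : Type*} [Fintype α] (X : Finset α) :
    (X.card : ℝ) ≤ √(Fintype.card α) * √X.card := by
  conv_lhs => rw [← Real.mul_self_sqrt (Nat.cast_nonneg X.card)]
  gcongr
  exact X.card_le_univ

-- Testing the previous estimate on the full vertex set shows that d differs from the interval
-- length by at most `mixingError p`. The density may thus be replaced by d/p at the cost of
-- doubling the error.
open Classical in
theorem abs_sum_adj_sub_le (hp : p ≠ 2) {t d : ℕ} (hd : IsRegular (Q p t) d)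
    (X Y : Finset (Fin p)) :
    |(∑ x ∈ X, ∑ y ∈ Y, if (Q p t).Adj x y then (1 : ℝ) else 0)
        - (d : ℝ) / p * (X.card * Y.card)|
      ≤ 2 * mixingError p * (√X.card * √Y.card) := by
  have hp0 : (0 : ℝ) < p := by exact_mod_cast (Fact.out : p.Prime).pos
  have hB := mixingError_nonneg p
  set m : ℝ := ((min (t + 1) p : ℕ) : ℝ) with hm
  have h1 := abs_sum_adj_sub_min_le hp t X Y
  have h2 := abs_sum_adj_sub_min_le hp t Finset.univ Finset.univ
  have e : ∀ x, (∑ y, if (Q p t).Adj x y then (1 : ℝ) else 0) = d := by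
    intro x
    rw [← hd x, ← SimpleGraph.card_neighborFinset_eq_degree, SimpleGraph.neighborFinset_eq_filter]
    simp
  rw [← hm] at h1 h2
  simp only [e, Finset.sum_const, Finset.card_univ, Fintype.card_fin, nsmul_eq_mul,
    Real.mul_self_sqrt hp0.le] at h2
  have e2 : (p : ℝ) * d - m / p * (p * p) = p * (d - m) := by field_simp
  rw [e2, abs_mul, abs_of_pos hp0, mul_comm (mixingError p)] at h2
  have h3 : |(d : ℝ) - m| ≤ mixingError p := le_of_mul_le_mul_left h2 hp0
  have hX := card_le_sqrt_mul_sqrt X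
  have hY := card_le_sqrt_mul_sqrt Y
  rw [Fintype.card_fin] at hX hY
  have hXY : (X.card * Y.card : ℝ) / p ≤ √X.card * √Y.card := by
    rw [div_le_iff₀ hp0]
    calc (X.card * Y.card : ℝ) ≤ (√p * √X.card) * (√p * √Y.card) := by gcongr
      _ = √X.card * √Y.card * (√p * √p) := by ring
      _ = _ := by rw [Real.mul_self_sqrt hp0.le]
  have h4 : |(d : ℝ) / p * (X.card * Y.card) - m / p * (X.card * Y.card)|
      ≤ mixingError p * (√X.card * √Y.card) := by
    have : (d : ℝ) / p * (X.card * Y.card) - m / p * (X.card * Y.card)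
        = (d - m) * ((X.card * Y.card) / p) := by ring
    rw [this, abs_mul, abs_of_nonneg (a := (X.card * Y.card : ℝ) / p) (by positivity)]
    gcongr
  rw [abs_le] at h1 h4 ⊢
  constructor <;> linarith [h1.1, h1.2, h4.1, h4.2]

end Mixing

/-! ### Discrepancy of `𝒜` from density 1/2 -/

section Discrepancy

/-- The bound q on each entry is what removes the logarithm that Cauchy–Schwarz would give. In the
induction, a and b are the values of √(q·sum) before and after adding z. Then b² - a² = qz and a + b
≤ 2b ≤ 2q√(n + 1), so z/√(n + 1) ≤ 2(b - a), and the right-hand side telescopes. -/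
theorem sum_div_sqrt_le {q : ℝ} (hq : 0 ≤ q) :
    ∀ (n : ℕ) (x : Fin n → ℝ), (∀ i, 0 ≤ x i) → (∀ i, x i ≤ q) →
      ∑ i, x i / √((i.val : ℝ) + 1) ≤ 2 * √(q * ∑ i, x i) := by
  intro n
  induction n with
  | zero => intro x _ _; simp
  | succ n ih =>
    intro x h0 h1
    have ih' := ih (fun i => x i.castSucc) (fun i => h0 _) (fun i => h1 _)
    have hS : ∑ i : Fin (n + 1), x i ≤ q * (n + 1) := by
      refine (Finset.sum_le_sum fun i _ => h1 i).trans (le_of_eq ?_)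
      simp [mul_comm]
    rw [Fin.sum_univ_castSucc] at hS
    rw [Fin.sum_univ_castSucc, Fin.sum_univ_castSucc]
    simp only [Fin.val_castSucc, Fin.val_last] at ih' ⊢
    have hS0 : 0 ≤ ∑ i : Fin n, x i.castSucc := Finset.sum_nonneg fun i _ => h0 _
    have hz0 := h0 (Fin.last n)
    have hz1 := h1 (Fin.last n)
    set S := ∑ i : Fin n, x i.castSucc
    set z := x (Fin.last n)
    rcases hq.eq_or_lt with rfl | hq
    · have : z = 0 := le_antisymm hz1 hz0
      simpa [this] using ih'
    have hr : 0 < √((n : ℝ) + 1) := Real.sqrt_pos.2 (by positivity)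
    have ha := Real.sq_sqrt (show 0 ≤ q * S by positivity)
    have hb := Real.sq_sqrt (show 0 ≤ q * (S + z) by positivity)
    have hab : √(q * S) ≤ √(q * (S + z)) := Real.sqrt_le_sqrt (by gcongr; linarith)
    have hbr : √(q * (S + z)) ≤ q * √((n : ℝ) + 1) := by
      rw [Real.sqrt_le_left (by positivity), mul_pow, Real.sq_sqrt (by positivity)]
      nlinarith
    set a := √(q * S)
    set b := √(q * (S + z))
    set r := √((n : ℝ) + 1)
    have hz : z ≤ 2 * (b - a) * r := by
      refine le_of_mul_le_mul_left ?_ hq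
      calc q * z = (b - a) * (b + a) := by linear_combination ha - hb
        _ ≤ (b - a) * (2 * (q * r)) := by
          refine mul_le_mul_of_nonneg_left ?_ (by linarith)
          linarith
        _ = _ := by ring
    have : z / r ≤ 2 * (b - a) := (div_le_iff₀ hr).2 hz
    linarith

theorem sum_sqrt_le {n : ℕ} (x : Fin n → ℝ) (h0 : ∀ i, 0 ≤ x i) :
    ∑ i, √(x i) ≤ √n * √(∑ i, x i) := by
  have := Real.sum_mul_le_sqrt_mul_sqrt Finset.univ (fun _ => (1 : ℝ)) (fun i => √(x i))
  simpa [Real.sq_sqrt (h0 _)] using this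

variable {p : ℕ}

open Classical in
/-- The part of `P` that lies in the class with index `i`. -/
noncomputable def slice (P : Finset (Half p)) (i : Fin (blockNumber p)) : Finset (Fin p) :=
  Finset.univ.filter fun u => (i, u) ∈ P

theorem sum_eq_sum_slice (P : Finset (Half p)) (f : Half p → ℝ) :
    ∑ x ∈ P, f x = ∑ i, ∑ u ∈ slice P i, f (i, u) :=
  Finset.sum_finset_product P Finset.univ (slice P) (by simp [slice])

theorem card_eq_sum_slice (P : Finset (Half p)) : (P.card : ℝ) = ∑ i, ((slice P i).card : ℝ) := by
  simpa using sum_eq_sum_slice P fun _ => 1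

theorem slice_card_le (P : Finset (Half p)) (i : Fin (blockNumber p)) :
    ((slice P i).card : ℝ) ≤ p := by
  have := (slice P i).card_le_univ
  rw [Fintype.card_fin] at this
  exact_mod_cast this

theorem sum_vertex_eq (X : Finset (Vertex p)) (f : Vertex p → ℝ) :
    ∑ x ∈ X, f x = ∑ x ∈ X.toLeft, f (Sum.inl x) + ∑ x ∈ X.toRight, f (Sum.inr x) := by
  conv_lhs => rw [← X.toLeft_disjSum_toRight]
  exact Finset.sum_disjSum _ _ _

variable [Fact p.Prime]

/-- The excess of `target p i j / p` over 1/2 is 1/(2√(ij)) in the numbering from 1, which gives the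
product term. The other term combines the mixing error with the error 2 from rounding to an
available degree. -/
theorem abs_block_discrepancy_le (hp : 5 ≤ p) (c : Choices p) (i j : Fin (blockNumber p))
    (X Y : Finset (Fin p)) :
    |∑ u ∈ X, ∑ v ∈ Y, (matrixA' p c (i, u) (j, v) - 1 / 2)|
      ≤ (2 * mixingError p + 2) * (√X.card * √Y.card)
        + 1 / 2 * ((X.card / √((i.val : ℝ) + 1)) * (Y.card / √((j.val : ℝ) + 1))) := by
  classical
  have hp0 : (0 : ℝ) < p := by exact_mod_cast (Fact.out : p.Prime).pos
  have h1 := abs_sum_adj_sub_le (by omega) (c.T_regular _ (c.D_mem i j)) X Y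
  have hD := abs_D_sub_target_le hp c i j
  have hX := card_le_sqrt_mul_sqrt X
  have hY := card_le_sqrt_mul_sqrt Y
  rw [Fintype.card_fin] at hX hY
  have hXY : (X.card * Y.card : ℝ) / p ≤ √X.card * √Y.card := by
    rw [div_le_iff₀ hp0]
    calc (X.card * Y.card : ℝ) ≤ (√p * √X.card) * (√p * √Y.card) := by gcongr
      _ = √X.card * √Y.card * (√p * √p) := by ring
      _ = _ := by rw [Real.mul_self_sqrt hp0.le]
  have hXY0 : 0 ≤ (X.card * Y.card : ℝ) / p := by positivity
  have e : ∑ u ∈ X, ∑ v ∈ Y, (matrixA' p c (i, u) (j, v) - 1 / 2)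
      = (∑ u ∈ X, ∑ v ∈ Y, if (Q p (c.T (c.D i j))).Adj u v then (1 : ℝ) else 0)
        - 1 / 2 * (X.card * Y.card) := by
    simp only [Finset.sum_sub_distrib, Finset.sum_const, nsmul_eq_mul, matrixA', Matrix.of_apply,
      SimpleGraph.adjMatrix_apply]
    ring
  have h2 : |(c.D i j : ℝ) / p * (X.card * Y.card) - target p i j / p * (X.card * Y.card)|
      ≤ 2 * (√X.card * √Y.card) := by
    have : (c.D i j : ℝ) / p * (X.card * Y.card) - target p i j / p * (X.card * Y.card)
        = (c.D i j - target p i j) * ((X.card * Y.card) / p) := by ring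
    rw [this, abs_mul, abs_of_nonneg hXY0]
    gcongr
  have h3 : target p i j / p * (X.card * Y.card) - 1 / 2 * (X.card * Y.card)
      = 1 / 2 * ((X.card / √((i.val : ℝ) + 1)) * (Y.card / √((j.val : ℝ) + 1))) := by
    rw [target, Real.sqrt_mul (by positivity)]
    field_simp
    ring
  have h4 : 0 ≤ 1 / 2 * ((X.card / √((i.val : ℝ) + 1)) * (Y.card / √((j.val : ℝ) + 1))) := by
    positivity
  rw [e]
  rw [abs_le] at h1 h2 ⊢
  constructor <;> linarith [h1.1, h1.2, h2.1, h2.2]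

/-- Noise: Cauchy–Schwarz over the classes, applied to each set, gives a factor k and hence at most
p by `hk`. Rank one part: (1/2)·2·2 = 2 times p by `sum_div_sqrt_le`. Together 3p. -/
theorem abs_half_discrepancy_le (hp : 5 ≤ p)
    (hk : (2 * mixingError p + 2) * blockNumber p ≤ p) (c : Choices p) (P R : Finset (Half p)) :
    |∑ x ∈ P, ∑ y ∈ R, (matrixA' p c x y - 1 / 2)| ≤ 3 * p * (√P.card * √R.card) := by
  have hp0 : (0 : ℝ) ≤ p := Nat.cast_nonneg p
  have hB := mixingError_nonneg p
  have e : ∑ x ∈ P, ∑ y ∈ R, (matrixA' p c x y - 1 / 2)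
      = ∑ i, ∑ j, ∑ u ∈ slice P i, ∑ v ∈ slice R j, (matrixA' p c (i, u) (j, v) - 1 / 2) := by
    rw [sum_eq_sum_slice]
    refine Finset.sum_congr rfl fun i _ => ?_
    refine Eq.trans ?_ Finset.sum_comm
    exact Finset.sum_congr rfl fun u _ => sum_eq_sum_slice R _
  rw [e]
  have s1 : ∀ Z : Finset (Half p),
      ∑ i, √((slice Z i).card : ℝ) ≤ √(blockNumber p) * √Z.card := by
    intro Z
    rw [card_eq_sum_slice Z]
    exact sum_sqrt_le _ fun i => Nat.cast_nonneg _
  have s2 : ∀ Z : Finset (Half p),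
      ∑ i : Fin (blockNumber p), ((slice Z i).card : ℝ) / √((i.val : ℝ) + 1)
        ≤ 2 * (√p * √Z.card) := by
    intro Z
    rw [card_eq_sum_slice Z, ← Real.sqrt_mul hp0]
    exact sum_div_sqrt_le hp0 _ _ (fun i => Nat.cast_nonneg _) (slice_card_le Z)
  calc _ ≤ ∑ i, ∑ j, |∑ u ∈ slice P i, ∑ v ∈ slice R j, (matrixA' p c (i, u) (j, v) - 1 / 2)| :=
        (Finset.abs_sum_le_sum_abs _ _).trans
          (Finset.sum_le_sum fun i _ => Finset.abs_sum_le_sum_abs _ _)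
    _ ≤ ∑ i, ∑ j, ((2 * mixingError p + 2) * (√(slice P i).card * √(slice R j).card)
        + 1 / 2 * (((slice P i).card / √((i.val : ℝ) + 1))
          * ((slice R j).card / √((j.val : ℝ) + 1)))) :=
        Finset.sum_le_sum fun i _ => Finset.sum_le_sum fun j _ =>
          abs_block_discrepancy_le hp c i j _ _
    _ = (2 * mixingError p + 2) * ((∑ i, √(slice P i).card) * ∑ j, √(slice R j).card)
        + 1 / 2 * ((∑ i : Fin (blockNumber p), (slice P i).card / √((i.val : ℝ) + 1))
          * ∑ j : Fin (blockNumber p), (slice R j).card / √((j.val : ℝ) + 1)) := by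
        simp_rw [Finset.sum_add_distrib, Finset.sum_mul_sum, Finset.mul_sum]
    _ ≤ (2 * mixingError p + 2) * ((√(blockNumber p) * √P.card) * (√(blockNumber p) * √R.card))
        + 1 / 2 * ((2 * (√p * √P.card)) * (2 * (√p * √R.card))) := by
        have n1 : ∀ Z : Finset (Half p), 0 ≤ ∑ i, √((slice Z i).card : ℝ) :=
          fun Z => Finset.sum_nonneg fun i _ => Real.sqrt_nonneg _
        have n2 : ∀ Z : Finset (Half p),
            0 ≤ ∑ i : Fin (blockNumber p), ((slice Z i).card : ℝ) / √((i.val : ℝ) + 1) :=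
          fun Z => Finset.sum_nonneg fun i _ => by positivity
        have m1 := mul_le_mul (s1 P) (s1 R) (n1 R) ((n1 P).trans (s1 P))
        have m2 := mul_le_mul (s2 P) (s2 R) (n2 R) ((n2 P).trans (s2 P))
        gcongr
    _ = ((2 * mixingError p + 2) * (√(blockNumber p) * √(blockNumber p)) + 2 * (√p * √p))
        * (√P.card * √R.card) := by ring
    _ ≤ 3 * p * (√P.card * √R.card) := by
        rw [Real.mul_self_sqrt (Nat.cast_nonneg _), Real.mul_self_sqrt hp0]
        gcongr
        linarith

theorem abs_discrepancy_le (hp : 5 ≤ p)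
    (hk : (2 * mixingError p + 2) * blockNumber p ≤ p) (c : Choices p) (X Y : Finset (Vertex p)) :
    |∑ x ∈ X, ∑ y ∈ Y, (matrixA p c x y - 1 / 2)| ≤ 12 * p * (√X.card * √Y.card) := by
  have hp0 : (0 : ℝ) ≤ p := Nat.cast_nonneg p
  have hc : ∀ x y, (1 : ℝ) - matrixA' p c x y - 1 / 2 = -(matrixA' p c x y - 1 / 2) := by
    intro x y; ring
  simp only [sum_vertex_eq, Finset.sum_add_distrib, matrixA, Matrix.fromBlocks_apply₁₁,
    Matrix.fromBlocks_apply₁₂, Matrix.fromBlocks_apply₂₁, Matrix.fromBlocks_apply₂₂,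
    Matrix.sub_apply, Matrix.of_apply, hc, Finset.sum_neg_distrib]
  have key : ∀ P R : Finset (Half p), P.card ≤ X.card → R.card ≤ Y.card →
      |∑ x ∈ P, ∑ y ∈ R, (matrixA' p c x y - 1 / 2)| ≤ 3 * p * (√X.card * √Y.card) := by
    intro P R hP hR
    refine (abs_half_discrepancy_le hp hk c P R).trans ?_
    gcongr
  have h1 := key _ _ X.card_toLeft_le Y.card_toLeft_le
  have h2 := key _ _ X.card_toLeft_le Y.card_toRight_le
  have h3 := key _ _ X.card_toRight_le Y.card_toLeft_le
  have h4 := key _ _ X.card_toRight_le Y.card_toRight_le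
  rw [abs_le] at *
  constructor <;> linarith [h1.1, h1.2, h2.1, h2.2, h3.1, h3.2, h4.1, h4.2]

end Discrepancy

/-! ### Regularity of `G_p` and the condition D(α) -/

section Graph

variable {p : ℕ} (c : Choices p)

open Classical in
theorem matrixA_eq_ite (x y : Vertex p) :
    matrixA p c x y = if (graph p c).Adj x y then 1 else 0 := by
  have := (matrixA_isAdjMatrix p c).zero_or_one x y
  by_cases h : matrixA p c x y = 1
  · simp [graph, h]
  · rcases this with h' | h'
    · simp [graph, h']
    · exact absurd h' h

theorem edgeCount_graph (X Y : Finset (Vertex p)) :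
    (edgeCount (graph p c) X Y : ℝ) = ∑ x ∈ X, ∑ y ∈ Y, matrixA p c x y := by
  classical
  simp_rw [matrixA_eq_ite, edgeCount, SimpleGraph.interedges, Rel.interedges]
  rw [Finset.card_filter, Finset.sum_product]
  push_cast
  congr! 4

theorem sum_matrixA (x : Vertex p) : ∑ y, matrixA p c x y = blockNumber p * p := by
  rw [Fintype.sum_sum_type, ← Finset.sum_add_distrib]
  rcases x with x | x <;> simp [matrixA]

theorem isRegular_graph : IsRegular (graph p c) (blockNumber p * p) := by
  classical
  unfold IsRegular
  intro x
  have h := sum_matrixA c x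
  simp_rw [matrixA_eq_ite] at h
  rw [← SimpleGraph.card_neighborFinset_eq_degree, SimpleGraph.neighborFinset_eq_filter,
    Finset.card_filter]
  exact_mod_cast h

theorem card_vertex : Fintype.card (Vertex p) = 2 * blockNumber p * p := by
  simp [Fintype.card_sum, Fintype.card_prod]; ring

theorem vol_graph (X : Finset (Vertex p)) :
    (vol (graph p c) X : ℝ) = blockNumber p * p * X.card := by
  classical
  have h : ∀ v, (graph p c).degree v = blockNumber p * p := fun v => isRegular_graph c v
  rw [vol, Finset.sum_congr rfl fun v _ => h v]
  simp [mul_comm]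

theorem matrixA_symm (x y : Vertex p) : matrixA p c x y = matrixA p c y x :=
  (matrixA_isAdjMatrix p c).symm.apply y x

theorem sum_matrixA_sub_half (x : Vertex p) : ∑ y, (matrixA p c x y - 1 / 2) = 0 := by
  rw [Finset.sum_sub_distrib, sum_matrixA]
  simp
  ring

theorem card_compl_vertex [DecidableEq (Vertex p)] (X : Finset (Vertex p)) :
    ((Xᶜ).card : ℝ) = 2 * (blockNumber p * p) - X.card := by
  have := X.card_add_card_compl
  rw [card_vertex, mul_assoc] at this
  rw [eq_sub_iff_add_eq']
  exact_mod_cast this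

/-- Rows of `𝒜` - 1/2 sum to zero, so a set and its complement have opposite discrepancies. The
smaller of the two serves as Z: the larger contains at least kp of the 2kp vertices. -/
theorem exists_small_side (h0 : 0 < blockNumber p * p) (X : Finset (Vertex p)) :
    ∃ Z : Finset (Vertex p), (Z.card : ℝ) ≤ X.card * (Xᶜ).card / (blockNumber p * p) ∧
      ∀ Y : Finset (Vertex p), |∑ y ∈ Y, ∑ x ∈ Z, (matrixA p c y x - 1 / 2)|
        = |∑ y ∈ Y, ∑ x ∈ X, (matrixA p c y x - 1 / 2)| := by
  classical
  have h0' : (0 : ℝ) < blockNumber p * p := by exact_mod_cast h0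
  have hcard := card_compl_vertex X
  rcases le_total (X.card : ℝ) (Xᶜ).card with h | h
  · refine ⟨X, ?_, fun Y => rfl⟩
    rw [le_div_iff₀ h0']
    gcongr
    linarith
  · refine ⟨Xᶜ, ?_, fun Y => ?_⟩
    · rw [le_div_iff₀ h0', mul_comm (X.card : ℝ)]
      gcongr
      linarith
    · rw [← abs_neg, ← Finset.sum_neg_distrib]
      congr 1
      refine Finset.sum_congr rfl fun y _ => ?_
      have := Finset.sum_add_sum_compl X fun x => matrixA p c y x - 1 / 2
      rw [sum_matrixA_sub_half] at this
      linarith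

theorem volDiscrepancy_graph [Fact p.Prime] (hp : 5 ≤ p) (h0 : 0 < blockNumber p)
    (hk : (2 * mixingError p + 2) * blockNumber p ≤ p) :
    VolDiscrepancy (graph p c) (24 / (blockNumber p : ℝ)) := by
  classical
  intro X Y
  have hkp : 0 < blockNumber p * p := Nat.mul_pos h0 (by omega)
  have h0' : (0 : ℝ) < blockNumber p := by exact_mod_cast h0
  have hp' : (0 : ℝ) < p := by exact_mod_cast (by omega : 0 < p)
  obtain ⟨Z, hZ, hZX⟩ := exists_small_side c hkp X
  obtain ⟨W, hW, hWY⟩ := exists_small_side c hkp Y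
  have hsymm : ∀ P R : Finset (Vertex p), ∑ x ∈ P, ∑ y ∈ R, (matrixA p c x y - 1 / 2)
      = ∑ y ∈ R, ∑ x ∈ P, (matrixA p c y x - 1 / 2) := by
    intro P R
    rw [Finset.sum_comm]
    refine Finset.sum_congr rfl fun y _ => Finset.sum_congr rfl fun x _ => ?_
    rw [matrixA_symm c]
  have hbound : |∑ x ∈ X, ∑ y ∈ Y, (matrixA p c x y - 1 / 2)|
      ≤ 12 * p * (√(X.card * (Xᶜ).card / (blockNumber p * p))
        * √(Y.card * (Yᶜ).card / (blockNumber p * p))) := by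
    -- Each side is replaced in turn, with the symmetry of `𝒜` between the two replacements.
    rw [← hWY X, hsymm, ← hZX W]
    refine (abs_discrepancy_le hp hk c W Z).trans ?_
    rw [mul_comm (√(W.card : ℝ))]
    gcongr
  have hX := card_compl_vertex X
  have hY := card_compl_vertex Y
  have hXc : (0 : ℝ) ≤ 2 * (blockNumber p * p) - X.card := hX ▸ Nat.cast_nonneg _
  have hYc : (0 : ℝ) ≤ 2 * (blockNumber p * p) - Y.card := hY ▸ Nat.cast_nonneg _
  rw [hX, hY] at hbound
  simp only [vol_graph, edgeCount_graph, card_compl_vertex]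
  set a : ℝ := 2 * (blockNumber p * p) - X.card
  set b : ℝ := 2 * (blockNumber p * p) - Y.card
  have hcard : ((Finset.univ : Finset (Vertex p)).card : ℝ) = 2 * (blockNumber p * p) := by
    rw [Finset.card_univ, card_vertex]; push_cast; ring
  have hK : (0 : ℝ) < blockNumber p * p := by positivity
  have e1 : (blockNumber p * p * X.card : ℝ) * (blockNumber p * p * Y.card)
      / (blockNumber p * p * (2 * (blockNumber p * p))) = X.card * Y.card * (1 / 2) := by
    field_simp
  have e2 : ∑ x ∈ X, ∑ y ∈ Y, (matrixA p c x y - 1 / 2)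
      = ∑ x ∈ X, ∑ y ∈ Y, matrixA p c x y - X.card * Y.card * (1 / 2) := by
    simp only [Finset.sum_sub_distrib, Finset.sum_const, nsmul_eq_mul]
    ring
  have e3 : (blockNumber p * p * X.card : ℝ) * (blockNumber p * p * Y.card)
        * (blockNumber p * p * a) * (blockNumber p * p * b)
      = ((blockNumber p * p : ℝ) ^ 2) ^ 2 * ((X.card * a) * (Y.card * b)) := by
    ring
  rw [hcard, e1, ← e2, e3, Real.sqrt_mul (by positivity), Real.sqrt_sq (by positivity),
    Real.sqrt_mul (by positivity)]
  -- Dividing by vol V = 2(kp)² leaves α/2 on the right, against 12p/(kp) = 12/k on the left; hence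
  -- α = 24/k.
  refine hbound.trans (le_of_eq ?_)
  rw [Real.sqrt_div' _ hK.le, Real.sqrt_div' _ hK.le, div_mul_div_comm, Real.mul_self_sqrt hK.le]
  field_simp
  ring

end Graph

/-! ### Variational lower bound for `lambdaBar` -/

section Rayleigh

open Matrix

variable {V : Type*} [Fintype V]

theorem abs_one_sub_eigenvalue_le_lambdaBar (G : SimpleGraph V) (i : Fin (Fintype.card V))
    (hi : i.val ≠ 0) : |1 - lapEigenvalue G i| ≤ lambdaBar G :=
  le_ciSup (f := fun i : {i : Fin (Fintype.card V) // i.val ≠ 0} => |1 - lapEigenvalue G i.val|)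
    (Set.finite_range _).bddAbove ⟨i, hi⟩

/-- Parseval in an orthonormal eigenbasis, for L u and for u. -/
theorem eigenvalue_quadratic_form [DecidableEq V] {L : Matrix V V ℝ} (hL : L.IsHermitian) (u : V → ℝ) :
    u ⬝ᵥ L *ᵥ u = ∑ i, hL.eigenvalues i * ((hL.eigenvectorBasis i).ofLp ⬝ᵥ u) ^ 2 ∧
      u ⬝ᵥ u = ∑ i, ((hL.eigenvectorBasis i).ofLp ⬝ᵥ u) ^ 2 := by
  have hT : Lᵀ = L := by rw [← conjTranspose_eq_transpose_of_trivial]; exact hL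
  have h : ∀ w : V → ℝ, u ⬝ᵥ w = ∑ i, ((hL.eigenvectorBasis i).ofLp ⬝ᵥ u) *
      ((hL.eigenvectorBasis i).ofLp ⬝ᵥ w) := by
    intro w
    have := hL.eigenvectorBasis.sum_inner_mul_inner (WithLp.toLp 2 u) (WithLp.toLp 2 w)
    simp only [EuclideanSpace.inner_eq_star_dotProduct, star_trivial] at this
    rw [dotProduct_comm u w, ← this]
    refine Finset.sum_congr rfl fun i _ => ?_
    rw [dotProduct_comm w]
  refine ⟨?_, ?_⟩
  · rw [h]
    refine Finset.sum_congr rfl fun i _ => ?_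
    have e : (hL.eigenvectorBasis i).ofLp ⬝ᵥ L *ᵥ u
        = hL.eigenvalues i * ((hL.eigenvectorBasis i).ofLp ⬝ᵥ u) := by
      rw [dotProduct_mulVec, ← mulVec_transpose, hT, hL.mulVec_eigenvectorBasis, smul_dotProduct,
        smul_eq_mul]
    rw [e]; ring
  · rw [h]
    exact Finset.sum_congr rfl fun i _ => (sq _).symm

open Classical in
/-- If the quadratic form of the Laplacian is at most `1 - r` times the squared norm on the plane
spanned by two orthogonal vectors, then `r ≤ λ̄`. -/
theorem le_lambdaBar_of_plane (G : SimpleGraph V) {r : ℝ} (v w : V → ℝ)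
    (hvw : v ⬝ᵥ w = 0) (hv : v ≠ 0) (hw : w ≠ 0)
    (h : ∀ α β : ℝ, (α • v + β • w) ⬝ᵥ normalizedLaplacian G *ᵥ (α • v + β • w)
      ≤ (1 - r) * ((α • v + β • w) ⬝ᵥ (α • v + β • w))) :
    r ≤ lambdaBar G := by
  set hL := normalizedLaplacian_isHermitian G
  obtain ⟨x, -⟩ := Function.ne_iff.1 hv
  have hcard : 0 < Fintype.card V := Fintype.card_pos_iff.2 ⟨x⟩
  -- This is the enumeration that defines `eigenvalues` from `eigenvalues₀`, which makes `h3` below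
  -- true by `rfl`. The index `i₀` belongs to λ₀, the only eigenvalue omitted from `lambdaBar`.
  set e := Fintype.equivOfCardEq (β := V) (Fintype.card_fin (Fintype.card V))
  set z : Fin (Fintype.card V) := ⟨0, hcard⟩
  set i₀ : V := e z.rev with hi₀
  have hlow : ∀ i, i ≠ i₀ → 1 - lambdaBar G ≤ hL.eigenvalues i := by
    intro i hi
    have hne : (e.symm i).rev.val ≠ 0 := by
      intro h0
      apply hi
      have : (e.symm i).rev = z := Fin.ext h0
      rw [hi₀, ← this, Fin.rev_rev, e.apply_symm_apply]
    have := abs_one_sub_eigenvalue_le_lambdaBar G _ hne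
    rw [lapEigenvalue, Fin.rev_rev] at this
    have h2 := (abs_le.1 this).2
    have h3 : hL.eigenvalues i = hL.eigenvalues₀ (e.symm i) := rfl
    rw [h3]
    linarith
  set b := (hL.eigenvectorBasis i₀).ofLp
  -- A plane contains a nonzero vector orthogonal to the eigenvector of λ₀. On it only the
  -- eigenvalues controlled by `hlow` contribute, so λ₀ need not be identified.
  obtain ⟨α, β, hu, hb⟩ : ∃ α β : ℝ, α • v + β • w ≠ 0 ∧ b ⬝ᵥ (α • v + β • w) = 0 := by
    by_cases hbv : b ⬝ᵥ v = 0
    · exact ⟨1, 0, by simpa using hv, by simpa using hbv⟩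
    · refine ⟨-(b ⬝ᵥ w), b ⬝ᵥ v, fun h0 => ?_, ?_⟩
      · have h1 : (-(b ⬝ᵥ w) • v + (b ⬝ᵥ v) • w) ⬝ᵥ w = 0 := by rw [h0, zero_dotProduct]
        rw [add_dotProduct, smul_dotProduct, smul_dotProduct, hvw, smul_zero, zero_add,
          smul_eq_mul] at h1
        exact mul_ne_zero hbv (fun h2 => hw (dotProduct_self_eq_zero.1 h2)) h1
      · simp only [dotProduct_add, dotProduct_smul, smul_eq_mul]
        ring
  have hmain := h α β
  set u := α • v + β • w
  obtain ⟨q1, q2⟩ := eigenvalue_quadratic_form hL u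
  have hge : (1 - lambdaBar G) * (u ⬝ᵥ u) ≤ u ⬝ᵥ normalizedLaplacian G *ᵥ u := by
    rw [q1, q2, Finset.mul_sum]
    refine Finset.sum_le_sum fun i _ => ?_
    by_cases hi : i = i₀
    · rw [hi, hb]; simp
    · exact mul_le_mul_of_nonneg_right (hlow i hi) (sq_nonneg _)
  have hpos : 0 < u ⬝ᵥ u := by
    refine lt_of_le_of_ne (Finset.sum_nonneg fun i _ => mul_self_nonneg _) ?_
    exact fun h0 => hu (dotProduct_self_eq_zero.1 h0.symm)
  have := le_of_mul_le_mul_right (hge.trans hmain) hpos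
  linarith

-- The plane is spanned by v and the constant vector 1. Since A1 = d1 and v ⊥ 1, the form of A has
-- no cross term, and r ≤ 1 handles the constant direction.
open Classical in
theorem le_lambdaBar_of_isRegular (G : SimpleGraph V) {d : ℕ} (hd : 0 < d) (hG : IsRegular G d)
    {r : ℝ} (hr : r ≤ 1) {v : V → ℝ} (hv : v ≠ 0) (hsum : ∑ x, v x = 0)
    (h : r * d * (v ⬝ᵥ v) ≤ v ⬝ᵥ G.adjMatrix ℝ *ᵥ v) : r ≤ lambdaBar G := by
  have hd' : (0 : ℝ) < d := by exact_mod_cast hd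
  set A := G.adjMatrix ℝ
  have hA1 : A *ᵥ 1 = (d : ℝ) • (1 : V → ℝ) := by
    ext x
    have := hG x
    simp [A, Pi.one_def, this]
  have hAT : Aᵀ = A := G.transpose_adjMatrix
  have hsum' : (1 : V → ℝ) ⬝ᵥ v = 0 := by simpa [dotProduct] using hsum
  have h1A : (1 : V → ℝ) ⬝ᵥ A *ᵥ v = 0 := by
    rw [dotProduct_mulVec, ← mulVec_transpose, hAT, hA1, smul_dotProduct, hsum', smul_zero]
  obtain ⟨x, -⟩ := Function.ne_iff.1 hv
  have : Nonempty V := ⟨x⟩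
  refine le_lambdaBar_of_plane G 1 v hsum' one_ne_zero hv fun α β => ?_
  rw [normalizedLaplacian_of_isRegular G d hd hG]
  have h11 : 0 ≤ (1 : V → ℝ) ⬝ᵥ 1 := Finset.sum_nonneg fun i _ => mul_self_nonneg _
  have hv1 : v ⬝ᵥ (1 : V → ℝ) = 0 := by rw [dotProduct_comm, hsum']
  have q : (α • 1 + β • v) ⬝ᵥ A *ᵥ (α • 1 + β • v)
      = d * α ^ 2 * ((1 : V → ℝ) ⬝ᵥ 1) + β ^ 2 * (v ⬝ᵥ A *ᵥ v) := by
    simp only [mulVec_add, mulVec_smul, add_dotProduct, dotProduct_add, smul_dotProduct,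
      dotProduct_smul, smul_eq_mul, hA1, h1A, hv1]
    ring
  have q' : (α • 1 + β • v) ⬝ᵥ (α • 1 + β • v)
      = α ^ 2 * ((1 : V → ℝ) ⬝ᵥ 1) + β ^ 2 * (v ⬝ᵥ v) := by
    simp only [add_dotProduct, dotProduct_add, smul_dotProduct,
      dotProduct_smul, smul_eq_mul, hsum', hv1]
    ring
  have key : r * d * ((α • 1 + β • v) ⬝ᵥ (α • 1 + β • v))
      ≤ (α • 1 + β • v) ⬝ᵥ A *ᵥ (α • 1 + β • v) := by
    rw [q, q']
    have k1 : 0 ≤ (1 - r) * (d * α ^ 2 * ((1 : V → ℝ) ⬝ᵥ 1)) :=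
      mul_nonneg (by linarith) (by positivity)
    have k2 := mul_le_mul_of_nonneg_left h (sq_nonneg β)
    linarith
  rw [sub_mulVec, one_mulVec, smul_mulVec, dotProduct_sub, dotProduct_smul, smul_eq_mul, sub_mul,
    one_mul]
  refine sub_le_sub_left ?_ _
  rw [one_div, ← div_eq_inv_mul, le_div_iff₀ hd']
  linarith

end Rayleigh

/-! ### The test vector and the lower bound for `lambdaBar` -/

section LowerBound

open Matrix

variable {p : ℕ}

/-- The test vector for the lower bound on `λ̄`. -/
noncomputable def testVector (p : ℕ) : Vertex p → ℝ :=
  Sum.elim (fun x => 1 / √((x.1.val : ℝ) + 1)) (fun x => -(1 / √((x.1.val : ℝ) + 1)))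

theorem sum_testVector : ∑ x, testVector p x = 0 := by
  rw [Fintype.sum_sum_type]
  simp [testVector]

theorem testVector_dotProduct_self :
    testVector p ⬝ᵥ testVector p = 2 * p * ∑ i : Fin (blockNumber p), 1 / ((i.val : ℝ) + 1) := by
  have e : ∀ i : Fin (blockNumber p), (√((i.val : ℝ) + 1))⁻¹ * (√((i.val : ℝ) + 1))⁻¹
      = ((i.val : ℝ) + 1)⁻¹ := by
    intro i
    rw [← mul_inv, Real.mul_self_sqrt (by positivity)]
  rw [dotProduct, Fintype.sum_sum_type]
  simp only [testVector, Sum.elim_inl, Sum.elim_inr, Fintype.sum_prod_type, one_div, neg_mul_neg, e,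
    Finset.sum_const, Finset.card_univ, Fintype.card_fin, nsmul_eq_mul]
  rw [← Finset.mul_sum]
  ring

theorem sum_matrixA'_row [Fact p.Prime] (c : Choices p) (i j : Fin (blockNumber p)) (u : Fin p) :
    ∑ v, matrixA' p c (i, u) (j, v) = c.D i j := by
  classical
  have h := c.T_regular _ (c.D_mem i j) u
  rw [← SimpleGraph.card_neighborFinset_eq_degree, SimpleGraph.neighborFinset_eq_filter,
    Finset.card_filter] at h
  simp only [matrixA', Matrix.of_apply, SimpleGraph.adjMatrix_apply]
  exact_mod_cast h

/-- The signs of the two halves combine the four copies of an entry a of `𝒜'` into 2a - 2(1 - a) =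
4a - 2. The vector is constant on classes, so only the row sums `c.D i j` of the blocks matter. -/
theorem testVector_quadratic_form [Fact p.Prime] (c : Choices p) :
    testVector p ⬝ᵥ matrixA p c *ᵥ testVector p
      = ∑ i : Fin (blockNumber p), ∑ j : Fin (blockNumber p),
        1 / √((i.val : ℝ) + 1) * (1 / √((j.val : ℝ) + 1)) * (p * (4 * c.D i j - 2 * p)) := by
  have e : testVector p ⬝ᵥ matrixA p c *ᵥ testVector p
      = ∑ x : Half p, ∑ y : Half p, 1 / √((x.1.val : ℝ) + 1) * (1 / √((y.1.val : ℝ) + 1)) *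
        (4 * matrixA' p c x y - 2) := by
    simp only [dotProduct, mulVec, Fintype.sum_sum_type, testVector, Sum.elim_inl, Sum.elim_inr,
      matrixA, fromBlocks_apply₁₁, fromBlocks_apply₁₂, fromBlocks_apply₂₁, fromBlocks_apply₂₂,
      Matrix.sub_apply, Matrix.of_apply]
    rw [← Finset.sum_add_distrib]
    refine Finset.sum_congr rfl fun x _ => ?_
    rw [← Finset.sum_add_distrib, ← Finset.sum_add_distrib, Finset.mul_sum, Finset.mul_sum,
      ← Finset.sum_add_distrib]
    refine Finset.sum_congr rfl fun y _ => ?_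
    ring
  rw [e]
  simp only [Fintype.sum_prod_type]
  refine Finset.sum_congr rfl fun i _ => ?_
  rw [Finset.sum_comm]
  refine Finset.sum_congr rfl fun j _ => ?_
  simp_rw [← Finset.mul_sum, Finset.sum_sub_distrib, ← Finset.mul_sum, sum_matrixA'_row]
  simp only [Finset.sum_const, Finset.card_univ, Fintype.card_fin, nsmul_eq_mul]
  ring

/-- Up to an error 8 from rounding, 4 `c.D i j` - 2p equals 2p times the product of the weights, so
the main term factors into a square. Cauchy–Schwarz bounds the square of the sum of weights in the
error term by k times the harmonic sum. -/
theorem testVector_quadratic_form_ge [Fact p.Prime] (hp : 5 ≤ p) (c : Choices p) :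
    2 * (p : ℝ) ^ 2 * (∑ i : Fin (blockNumber p), 1 / ((i.val : ℝ) + 1)) ^ 2
        - 8 * p * blockNumber p * ∑ i : Fin (blockNumber p), 1 / ((i.val : ℝ) + 1)
      ≤ testVector p ⬝ᵥ matrixA p c *ᵥ testVector p := by
  set w : Fin (blockNumber p) → ℝ := fun i => 1 / √((i.val : ℝ) + 1) with hw
  have hw0 : ∀ i, 0 ≤ w i := fun i => by positivity
  have hw2 : ∀ i : Fin (blockNumber p), 1 / ((i.val : ℝ) + 1) = w i ^ 2 := by
    intro i
    rw [hw, div_pow, Real.sq_sqrt (by positivity), one_pow]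
  simp_rw [hw2]
  rw [testVector_quadratic_form]
  have hterm : ∀ i j, 2 * (p : ℝ) ^ 2 * (w i ^ 2 * w j ^ 2) - 8 * p * (w i * w j)
      ≤ w i * w j * (p * (4 * c.D i j - 2 * p)) := by
    intro i j
    have h1 := (abs_le.1 (abs_D_sub_target_le hp c i j)).1
    have h2 : target p i j = p / 2 + p / 2 * (w i * w j) := by
      rw [target, Real.sqrt_mul (by positivity), hw]
      ring
    rw [h2] at h1
    have h3 : 2 * (p : ℝ) * (w i * w j) - 8 ≤ 4 * c.D i j - 2 * p := by linarith
    calc _ = w i * w j * (p * (2 * (p : ℝ) * (w i * w j) - 8)) := by ring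
      _ ≤ _ := by
        have := mul_nonneg (hw0 i) (hw0 j)
        gcongr
  refine le_trans ?_ (Finset.sum_le_sum fun i _ => Finset.sum_le_sum fun j _ => hterm i j)
  simp_rw [Finset.sum_sub_distrib, ← Finset.mul_sum, ← Finset.sum_mul]
  have hcs := Finset.sum_mul_sq_le_sq_mul_sq Finset.univ (fun _ => (1 : ℝ)) w
  simp only [one_mul, one_pow, Finset.sum_const, Finset.card_univ, Fintype.card_fin, nsmul_eq_mul,
    mul_one] at hcs
  have hp0 : (0 : ℝ) ≤ p := Nat.cast_nonneg p
  have := mul_le_mul_of_nonneg_left hcs (show (0 : ℝ) ≤ 8 * p by positivity)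
  linarith

theorem log_div_le_lambdaBar [Fact p.Prime] (hp : 5 ≤ p) (hk0 : 0 < blockNumber p)
    (hk : 8 * (blockNumber p : ℝ) ≤ p) (c : Choices p) :
    Real.log (blockNumber p : ℝ) / (2 * (blockNumber p : ℝ)) ≤ lambdaBar (graph p c) := by
  classical
  have hk0' : (0 : ℝ) < blockNumber p := by exact_mod_cast hk0
  have hp0 : (0 : ℝ) < p := by exact_mod_cast (by omega : 0 < p)
  set H : ℝ := ∑ i : Fin (blockNumber p), 1 / ((i.val : ℝ) + 1) with hH
  have hH1 : 1 ≤ H := by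
    have := Finset.single_le_sum (f := fun i : Fin (blockNumber p) => 1 / ((i.val : ℝ) + 1))
      (fun i _ => by positivity) (Finset.mem_univ ⟨0, hk0⟩)
    exact le_trans (le_of_eq (by simp)) this
  have hHlog : Real.log (blockNumber p) ≤ H := by
    have h1 := log_add_one_le_harmonic (blockNumber p)
    have h2 : ((harmonic (blockNumber p) : ℚ) : ℝ) = H := by
      rw [hH, Fin.sum_univ_eq_sum_range (fun i : ℕ => 1 / ((i : ℝ) + 1))]
      simp [harmonic]
    rw [h2] at h1
    refine le_trans ?_ h1
    gcongr
    omega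
  have hvv := testVector_dotProduct_self (p := p)
  have hA := testVector_quadratic_form_ge hp c
  have hmat : matrixA p c = (graph p c).adjMatrix ℝ := by
    ext x y
    rw [matrixA_eq_ite, SimpleGraph.adjMatrix_apply]
  rw [← hH] at hvv hA
  rw [hmat] at hA
  refine le_lambdaBar_of_isRegular (graph p c) (Nat.mul_pos hk0 (by omega)) (isRegular_graph c)
    ?_ (v := testVector p) ?_ sum_testVector (le_trans ?_ hA)
  · rw [div_le_one (by positivity)]
    have := Real.log_le_sub_one_of_pos hk0'
    linarith
  · intro h0
    rw [h0, zero_dotProduct] at hvv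
    have : 0 < 2 * (p : ℝ) * H := by positivity
    linarith
  · rw [hvv]
    push_cast
    have e : Real.log (blockNumber p) / (2 * blockNumber p) * (blockNumber p * p) * (2 * p * H)
        = p * H * (p * Real.log (blockNumber p)) := by field_simp
    rw [e]
    -- One copy of pH dominates p log k; the other, at least p since H ≥ 1, absorbs the rounding
    -- loss 8k.
    have h1 : (p : ℝ) * Real.log (blockNumber p) ≤ 2 * p * H - 8 * blockNumber p := by
      have := mul_le_mul_of_nonneg_left hHlog hp0.le
      have := mul_le_mul_of_nonneg_left hH1 hp0.le
      linarith
    have := mul_le_mul_of_nonneg_left h1 (show 0 ≤ (p : ℝ) * H by positivity)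
    refine this.trans (le_of_eq ?_)
    ring

end LowerBound

/-! ### Large primes and the conclusion -/

section Asymptotics

open Filter

theorem tendsto_blockNumber : Tendsto (fun p : ℕ => (blockNumber p : ℝ)) atTop atTop := by
  refine tendsto_atTop_mono (fun p => Nat.le_ceil _) ?_
  exact (tendsto_rpow_atTop (by norm_num)).comp tendsto_natCast_atTop_atTop

theorem blockNumber_pos {p : ℕ} (hp : 0 < p) : 0 < blockNumber p :=
  Nat.ceil_pos.2 (Real.rpow_pos_of_pos (by exact_mod_cast hp) _)

/-- In terms of y = p^(1/10) one has p = y¹⁰, √p = y⁵, k ≤ 2y² and eventually log p ≤ y. The first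
product is then at most 16y⁸, and y ≥ 4 suffices. -/
theorem eventually_mixingError_mul_le :
    ∀ᶠ p : ℕ in atTop, (2 * mixingError p + 2) * blockNumber p ≤ p ∧
      8 * (blockNumber p : ℝ) ≤ p := by
  have h1 := ((isLittleO_log_rpow_atTop (show (0 : ℝ) < 1 / 10 by norm_num)).bound one_pos).and
    ((tendsto_rpow_atTop (show (0 : ℝ) < 1 / 10 by norm_num)).eventually_ge_atTop 4)
  have h2 := tendsto_natCast_atTop_atTop (R := ℝ) |>.eventually h1
  filter_upwards [h2, eventually_ge_atTop 1] with p ⟨hlog, hy⟩ hp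
  have hp0 : (0 : ℝ) ≤ p := Nat.cast_nonneg p
  set y : ℝ := (p : ℝ) ^ ((1 : ℝ) / 10) with hyd
  have hpow : ∀ n : ℕ, y ^ n = (p : ℝ) ^ ((n : ℝ) / 10) := by
    intro n
    rw [hyd, ← Real.rpow_natCast, ← Real.rpow_mul hp0]
    congr 1; ring
  have hy10 : (p : ℝ) = y ^ 10 := by rw [hpow]; norm_num
  have hy5 : √(p : ℝ) = y ^ 5 := by rw [hpow, Real.sqrt_eq_rpow]; norm_num
  have hk : (blockNumber p : ℝ) ≤ 2 * y ^ 2 := by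
    have h3 : (blockNumber p : ℝ) < (p : ℝ) ^ ((1 : ℝ) / 5) + 1 :=
      Nat.ceil_lt_add_one (by positivity)
    have h4 : (p : ℝ) ^ ((1 : ℝ) / 5) = y ^ 2 := by rw [hpow]; norm_num
    rw [h4] at h3
    nlinarith
  have hlog' : Real.log p ≤ y := by
    rw [one_mul, Real.norm_of_nonneg (Real.log_natCast_nonneg p),
      Real.norm_of_nonneg (by positivity)] at hlog
    exact hlog
  have hy1 : 1 ≤ y ^ 5 := one_le_pow₀ (by linarith)
  have hB : 2 * mixingError p + 2 ≤ 8 * y ^ 6 := by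
    have : √(p : ℝ) * (1 + Real.log p) ≤ y ^ 5 * (1 + y) := by
      rw [hy5]; gcongr
    have h6 : y ^ 6 = y ^ 5 * y := by ring
    rw [mixingError, h6]
    nlinarith
  have hB0 := mixingError_nonneg p
  have h16 : 16 ≤ y ^ 2 := by nlinarith
  constructor
  · calc (2 * mixingError p + 2) * blockNumber p ≤ (8 * y ^ 6) * (2 * y ^ 2) := by gcongr
      _ = 16 * y ^ 8 := by ring
      _ ≤ y ^ 2 * y ^ 8 := by gcongr
      _ = p := by rw [hy10]; ring
  · calc 8 * (blockNumber p : ℝ) ≤ 8 * (2 * y ^ 2) := by gcongr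
      _ = 16 * y ^ 2 := by ring
      _ ≤ y ^ 2 * y ^ 2 := by gcongr
      _ = 1 * y ^ 4 := by ring
      _ ≤ y ^ 6 * y ^ 4 := by gcongr; exact one_le_pow₀ (by linarith)
      _ = p := by rw [hy10]; ring

theorem exists_forall_prime_graph_properties :
    ∃ p₀ : ℕ, ∀ p : ℕ, p.Prime → p₀ ≤ p → ∀ c : Choices p,
      Fintype.card (Vertex p) = 2 * blockNumber p * p ∧
      IsRegular (graph p c) (blockNumber p * p) ∧
      VolDiscrepancy (graph p c) (24 / (blockNumber p : ℝ)) ∧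
      Real.log (blockNumber p : ℝ) / (2 * (blockNumber p : ℝ)) ≤ lambdaBar (graph p c) := by
  obtain ⟨p₀, h⟩ := eventually_atTop.1 (eventually_mixingError_mul_le.and (eventually_ge_atTop 5))
  refine ⟨p₀, fun p hp hpp c => ?_⟩
  have : Fact p.Prime := ⟨hp⟩
  obtain ⟨⟨h1, h2⟩, h5⟩ := h p hpp
  have hk := blockNumber_pos hp.pos
  exact ⟨card_vertex, isRegular_graph c, volDiscrepancy_graph c h5 hk h1,
    log_div_le_lambdaBar h5 hk h2 c⟩

theorem exists_forall_prime_lt_lambdaBar (K : ℝ) :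
    ∃ p₁ : ℕ, ∀ p : ℕ, p.Prime → p₁ ≤ p → ∀ c : Choices p,
      K * (24 / (blockNumber p : ℝ)) < lambdaBar (graph p c) := by
  obtain ⟨p₀, h⟩ := exists_forall_prime_graph_properties
  -- The inequality 24K/k < (log k)/(2k) amounts to 48K < log k.
  have hlog := (Real.tendsto_log_atTop.comp tendsto_blockNumber).eventually_gt_atTop (48 * K)
  obtain ⟨p₁, h1⟩ := eventually_atTop.1 hlog
  refine ⟨max p₀ p₁, fun p hp hpp c => ?_⟩
  have hk : (0 : ℝ) < blockNumber p := by exact_mod_cast blockNumber_pos hp.pos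
  refine lt_of_lt_of_le ?_ (h p hp ((le_max_left _ _).trans hpp) c).2.2.2
  have h2 : 48 * K < Real.log (blockNumber p) := h1 p ((le_max_right _ _).trans hpp)
  rw [lt_div_iff₀ (by positivity)]
  refine lt_of_eq_of_lt ?_ h2
  field_simp
  ring

theorem not_exists_lambdaBar_le_mul :
    ¬ ∃ K : ℝ, ∀ (V : Type) [Fintype V] (G : SimpleGraph V) (d : ℕ), G ≠ ⊥ →
      IsRegular G d → ∀ α : ℝ, 0 < α → VolDiscrepancy G α → lambdaBar G ≤ K * α := by
  rintro ⟨K, hK⟩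
  obtain ⟨p₀, h0⟩ := exists_forall_prime_graph_properties
  obtain ⟨p₁, h1⟩ := exists_forall_prime_lt_lambdaBar K
  obtain ⟨p, hpp, hp⟩ := Nat.exists_infinite_primes (max p₀ p₁)
  obtain ⟨c⟩ := nonempty_choices p hp.pos
  obtain ⟨-, hreg, hdisc, -⟩ := h0 p hp ((le_max_left _ _).trans hpp) c
  have hk := blockNumber_pos hp.pos
  have hk' : (0 : ℝ) < blockNumber p := by exact_mod_cast hk
  refine (h1 p hp ((le_max_right _ _).trans hpp) c).not_ge
    (hK _ (graph p c) _ (fun hbot => ?_) hreg _ (by positivity) hdisc)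
  classical
  have hx := hreg (Sum.inl (⟨0, hk⟩, ⟨0, hp.pos⟩))
  have hpos := Nat.mul_pos hk hp.pos
  rw [← SimpleGraph.card_neighborFinset_eq_degree] at hx
  obtain ⟨y, hy⟩ := Finset.card_pos.1 (hx ▸ hpos)
  rw [SimpleGraph.mem_neighborFinset, hbot] at hy
  exact hy

end Asymptotics

end ChungLaplacian

theorem mainTheorem5 :
    -- there is an absolute constant `C` such that, for all large primes `p`, the graph `G_p` has
    -- order `2kp`, is `kp`-regular, satisfies the condition with `α = C / k`, and has large `λ̄`
    (∃ C : ℝ, 0 < C ∧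
      (∃ p₀ : ℕ, ∀ p : ℕ, p.Prime → p₀ ≤ p → ∀ c : ChungLaplacian.Choices p,
        Fintype.card (ChungLaplacian.Vertex p) = 2 * ChungLaplacian.blockNumber p * p ∧
        ChungLaplacian.IsRegular (ChungLaplacian.graph p c) (ChungLaplacian.blockNumber p * p) ∧
        ChungLaplacian.VolDiscrepancy (ChungLaplacian.graph p c)
          (C / (ChungLaplacian.blockNumber p : ℝ)) ∧
        Real.log (ChungLaplacian.blockNumber p : ℝ) / (2 * (ChungLaplacian.blockNumber p : ℝ)) ≤
          ChungLaplacian.lambdaBar (ChungLaplacian.graph p c)) ∧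
      -- on these graphs `λ̄` exceeds any fixed multiple of `α = C / k`
      (∀ K : ℝ, ∃ p₁ : ℕ, ∀ p : ℕ, p.Prime → p₁ ≤ p → ∀ c : ChungLaplacian.Choices p,
        K * (C / (ChungLaplacian.blockNumber p : ℝ)) <
          ChungLaplacian.lambdaBar (ChungLaplacian.graph p c))) ∧
    -- no absolute constant works, even for nonempty regular graphs only
    (¬ ∃ K : ℝ, ∀ (V : Type) [Fintype V] (G : SimpleGraph V) (d : ℕ), G ≠ ⊥ →
      ChungLaplacian.IsRegular G d → ∀ α : ℝ, 0 < α →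
        ChungLaplacian.VolDiscrepancy G α → ChungLaplacian.lambdaBar G ≤ K * α) := by
  obtain ⟨p₀, h⟩ := ChungLaplacian.exists_forall_prime_graph_properties
  exact ⟨⟨24, by norm_num, ⟨p₀, h⟩, ChungLaplacian.exists_forall_prime_lt_lambdaBar⟩,
    ChungLaplacian.not_exists_lambdaBar_le_mul⟩
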